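/- Let $K$ be an algebraically closed field, $\Gamma$ a finite quiver with vertices $1,\dots,n$, $I$ an admissible ideal of the path algebra $K\Gamma$, and $\Lambda=K\Gamma/I$, with Jacobson radical $J$ and Loewy length $L+1$ (that is, $L+1$ is the least $k$ with $J^k=0$). Let $e_i$ be the idempotent and $S_i=\Lambda e_i/Je_i$ the simple module at the vertex $i$. Semisimple modules are identified with their isomorphism classes; a module $M$ has dimension vector $\mathbf d=(d_1,\dots,d_n)$ if $\dim_K e_iM=d_i$ for all $i$, its top is $M/JM$, and its radical layering is $\mathbb S(M)=(J^lM/J^{l+1}M)_{0\le l\le L}$. *Semisimple sequences and Grassmannians.* Let $\mathbb S=(\mathbb S_0,\dots,\mathbb S_L)$ be a semisimple sequence with dimension vector $\mathbf d$ and top $T=\mathbb S_0=\bigoplus_i S_i^{t_i}$: the $\mathbb S_l$ are semisimple, $\bigoplus_l\mathbb S_l$ has dimension vector $\mathbf d$, and $\mathbb S_l$ embeds in $J^lP/J^{l+1}P$ for $0\le l\le L$, where $P=\bigoplus_r\Lambda z_r$ is the distinguished projective cover of $T$ ($t_i$ of the summands $\Lambda z_r$ are copies of $\Lambda e_i$).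 Let $\mathbf P=\bigoplus_r\Lambda z_r$ be likewise the distinguished projective cover of $\bigoplus_iS_i^{d_i}$, and put $d=\sum_i d_i$. Define - $\mathfrak{Grass}^T_d$: the set of $\Lambda$-submodules $C\subseteq JP$ with $\dim_K C=\dim_K P-d$; $\mathfrak{Grass}^T_{\mathbf d}$: those $C\in\mathfrak{Grass}^T_d$ for which $P/C$ has dimension vector $\mathbf d$; $\mathfrak{Grass}(\mathbb S)=\{C\in\mathfrak{Grass}^T_{\mathbf d}\mid\mathbb S(P/C)=\mathbb S\}$; - $\mathrm{GRASS}_{\mathbf d}(\Lambda)$: the set of $\Lambda$-submodules $C\subseteq\mathbf P$ with $\dim_K C=\dim_K\mathbf P-d$ such that $\mathbf P/C$ has dimension vector $\mathbf d$; $\mathrm{GRASS}^T_{\mathbf d}$: those $C\in\mathrm{GRASS}_{\mathbf d}(\Lambda)$ for which $\mathbf P/C$ has top $T$; $\mathrm{GRASS}(\mathbb S)=\{C\in\mathrm{GRASS}_{\mathbf d}(\Lambda)\mid\mathbb S(\mathbf P/C)=\mathbb S\}$. All these sets carry the Zariski topology inherited from the classical Grassmannians of subspaces of $JP$ (equivalently,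 of $P$), respectively of $\mathbf P$. *Skeleta.* Let $Q$ be $P$ or $\mathbf P$, and let $\widehat Q=\bigoplus_rK\Gamma\widehat z_r$ be the corresponding projective $K\Gamma$-module, with $\widehat z_r$ normed by the same vertex $e(r)$ as $z_r$. A path in $\widehat Q$ is an element $p\widehat z_r$, where $p$ is a path of $\Gamma$ starting in $e(r)$. A skeleton in $\widehat Q$ with top $T$ is a set $\sigma$ of paths of length at most $L$ in $\widehat Q$, closed under initial subpaths, such that for each $i$ exactly $t_i$ of the $\widehat z_r\in\sigma$ are normed by $e_i$. It is compatible with $\mathbb S$ if, for all $l\le L$ and all $i$, the number of paths of length $l$ in $\sigma$ ending in the vertex $i$ is the multiplicity of $S_i$ in $\mathbb S_l$. It is a distinguished skeleton of $M=Q/C$ if the elements $x_r=z_r+C$ with $\widehat z_r\in\sigma$ form a full sequence of top elements of $M$ (they lie outside $JM$, generate $M$, and are linearly independent modulo $JM$) and, for each $l\le L$, the elements $p\,x_r$, with $p\widehat z_r\in\sigma$ of length $l$, induce a $K$-basis of $J^lM/J^{l+1}M$. Let $\mathfrak{Grass}(\sigma)\subseteq\mathfrak{Grass}^T_d$ (for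 $Q=P$) and $\mathrm{GRASS}(\sigma)\subseteq\mathrm{GRASS}_{\mathbf d}(\Lambda)$ (for $Q=\mathbf P$) be the sets of those points $C$ such that $\sigma$ is a distinguished skeleton of $Q/C$. Finally, define the intersections with big Schubert cells $$\mathrm{Schu}(\sigma)=\Bigl\{C\in\mathfrak{Grass}^T_{\mathbf d}\Bigm| JP=C\oplus\bigoplus_{p\widehat z_r\in\sigma,\ \operatorname{length}(p)>0}K\,pz_r\Bigr\},\qquad \mathrm{SCHU}(\sigma)=\Bigl\{C\in\mathrm{GRASS}_{\mathbf d}(\Lambda)\Bigm|\mathbf P=C\oplus\bigoplus_{p\widehat z_r\in\sigma}K\,pz_r\Bigr\},$$ where the $pz_r$ occurring are required to be linearly independent. **Corollary 3.8.** (a) For every skeleton $\sigma$ in $\widehat P$ (respectively, in $\widehat{\mathbf P}$) with top $T$ which is compatible with $\mathbb S$, the set $\mathfrak{Grass}(\sigma)$ is an open subset of $\mathfrak{Grass}(\mathbb S)$ and $\mathfrak{Grass}(\sigma)=\mathfrak{Grass}(\mathbb S)\cap\mathrm{Schu}(\sigma)$ (respectively, $\mathrm{GRASS}(\sigma)$ is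 an open subset of $\mathrm{GRASS}(\mathbb S)$ and $\mathrm{GRASS}(\sigma)=\mathrm{GRASS}(\mathbb S)\cap\mathrm{SCHU}(\sigma)$). As $\sigma$ runs through these skeleta, the sets $\mathfrak{Grass}(\sigma)$ cover $\mathfrak{Grass}(\mathbb S)$ (respectively, the sets $\mathrm{GRASS}(\sigma)$ cover $\mathrm{GRASS}(\mathbb S)$). (b) In general, these sets fail to be open in the larger varieties: for every algebraically closed field $K$ there exist $\Gamma$, $I$, $\mathbf d$, $\mathbb S$ as above and skeleta $\sigma$ in $\widehat P$ and $\sigma'$ in $\widehat{\mathbf P}$ with top $T=\mathbb S_0$, both compatible with $\mathbb S$, such that $\mathfrak{Grass}(\sigma)$ is open neither in $\mathfrak{Grass}^T_d$ nor in $\mathfrak{Grass}^T_{\mathbf d}$, and $\mathrm{GRASS}(\sigma')$ is not open in $\mathrm{GRASS}^T_{\mathbf d}$. -/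

import Mathlib

universe u v w x

noncomputable section

/-! ### The path algebra of a quiver -/

/-- A path of the quiver, bundled with its starting point and its end point. -/
abbrev QPath (V : Type u) [Quiver.{v} V] : Type (max u v) :=
  Σ i : V, Σ j : V, Quiver.Path i j

/-- The path algebra `KΓ`: the vector space with basis the paths of `Γ`. -/
def PathAlgebra (K : Type w) (V : Type u) [Field K] [Quiver.{v} V] : Type (max u v w) :=
  QPath V →₀ K

namespace PathAlgebra

variable {K : Type w} {V : Type u} [Field K] [Quiver.{v} V]

instance : AddCommGroup (PathAlgebra K V) := inferInstanceAs (AddCommGroup (QPath V →₀ K))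
instance : Module K (PathAlgebra K V) := inferInstanceAs (Module K (QPath V →₀ K))

variable (K) in
/-- A path, as an element of the path algebra. -/
def ofPath {i j : V} (p : Quiver.Path i j) : PathAlgebra K V :=
  (Finsupp.single (⟨i, j, p⟩ : QPath V) (1 : K) : QPath V →₀ K)

variable (K) in
open Classical in
/-- The product `p q` of two paths ("first `q`, then `p`"); it is zero unless the end point of `q`
is the starting point of `p`. -/
def pathMul (p q : QPath V) : PathAlgebra K V :=
  if h : q.2.1 = p.1 then ofPath K (q.2.2.comp (p.2.2.cast h.symm rfl)) else 0

variable (K V) in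
/-- The bilinear extension of the product of paths. -/
def mulHom : PathAlgebra K V →ₗ[K] PathAlgebra K V →ₗ[K] PathAlgebra K V :=
  Finsupp.linearCombination K (M := PathAlgebra K V →ₗ[K] PathAlgebra K V)
    fun p : QPath V =>
      (Finsupp.linearCombination K (M := PathAlgebra K V) fun q : QPath V => pathMul K p q)

instance : Mul (PathAlgebra K V) := ⟨fun a b => mulHom K V a b⟩

theorem mul_def (a b : PathAlgebra K V) : a * b = mulHom K V a b := rfl

/-- Paths form a basis: two linear maps agreeing on the paths are equal. -/
theorem hom_ext {M : Type*} [AddCommGroup M] [Module K M] {f g : PathAlgebra K V →ₗ[K] M}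
    (h : ∀ (i j : V) (p : Quiver.Path i j), f (ofPath K p) = g (ofPath K p)) : f = g := by
  refine Finsupp.lhom_ext' (M := K) fun p => LinearMap.ext_ring ?_
  exact h p.1 p.2.1 p.2.2

open Classical in
theorem ofPath_mul_ofPath {i j k l : V} (p : Quiver.Path i j) (q : Quiver.Path k l) :
    ofPath K p * ofPath K q =
      if h : l = i then ofPath K (q.comp (p.cast h.symm rfl)) else 0 := by
  rw [mul_def, mulHom, ofPath, ofPath]
  erw [Finsupp.linearCombination_single, one_smul, Finsupp.linearCombination_single, one_smul]
  rfl

theorem ofPath_mul_comp {i j k : V} (p : Quiver.Path j k) (q : Quiver.Path i j) :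
    ofPath K p * ofPath K q = ofPath K (q.comp p) := by
  rw [ofPath_mul_ofPath]; simp

theorem ofPath_mul_of_ne {i j k l : V} (p : Quiver.Path i j) (q : Quiver.Path k l) (h : l ≠ i) :
    ofPath K p * ofPath K q = 0 := by
  rw [ofPath_mul_ofPath, dif_neg h]

theorem assoc_paths {i j k l m n : V} (p : Quiver.Path i j) (q : Quiver.Path k l)
    (r : Quiver.Path m n) :
    (ofPath K p * ofPath K q) * ofPath K r = ofPath K p * (ofPath K q * ofPath K r) := by
  have z1 : ∀ a : PathAlgebra K V, 0 * a = 0 := fun a => by simp [mul_def]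
  have z2 : ∀ a : PathAlgebra K V, a * 0 = 0 := fun a => by simp [mul_def]
  by_cases h : l = i
  · subst h
    by_cases h' : n = k
    · subst h'
      simp only [ofPath_mul_comp, Quiver.Path.comp_assoc]
    · rw [ofPath_mul_comp, ofPath_mul_of_ne _ _ h', ofPath_mul_of_ne _ _ h', z2]
  · rw [ofPath_mul_of_ne _ _ h, z1]
    by_cases h' : n = k
    · subst h'
      rw [ofPath_mul_comp, ofPath_mul_of_ne _ _ h]
    · rw [ofPath_mul_of_ne _ _ h', z2]

protected theorem mul_assoc' (a b c : PathAlgebra K V) : (a * b) * c = a * (b * c) := by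
  have h1 : ∀ {i j k l : V} (p : Quiver.Path i j) (q : Quiver.Path k l) (c : PathAlgebra K V),
      (ofPath K p * ofPath K q) * c = ofPath K p * (ofPath K q * c) := by
    intro i j k l p q c
    have h : mulHom K V (ofPath K p * ofPath K q) =
        mulHom K V (ofPath K p) ∘ₗ mulHom K V (ofPath K q) :=
      hom_ext fun m n r => assoc_paths p q r
    exact LinearMap.congr_fun h c
  have h2 : ∀ {i j : V} (p : Quiver.Path i j) (b c : PathAlgebra K V),
      (ofPath K p * b) * c = ofPath K p * (b * c) := by
    intro i j p b c
    have h : (mulHom K V).flip c ∘ₗ mulHom K V (ofPath K p) =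
        mulHom K V (ofPath K p) ∘ₗ (mulHom K V).flip c :=
      hom_ext fun m n q => h1 p q c
    exact LinearMap.congr_fun h b
  have h3 : (mulHom K V).flip c ∘ₗ (mulHom K V).flip b = (mulHom K V).flip (b * c) :=
    hom_ext fun m n p => h2 p b c
  exact LinearMap.congr_fun h3 a

variable [Fintype V]

instance : One (PathAlgebra K V) := ⟨∑ i : V, ofPath K (Quiver.Path.nil : Quiver.Path i i)⟩

theorem one_def : (1 : PathAlgebra K V) = ∑ i : V, ofPath K (Quiver.Path.nil : Quiver.Path i i) :=
  rfl

protected theorem one_mul' (a : PathAlgebra K V) : 1 * a = a := by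
  have h : mulHom K V 1 = LinearMap.id := by
    refine hom_ext fun i j p => ?_
    rw [one_def, map_sum, LinearMap.sum_apply, Finset.sum_eq_single j]
    · rw [← mul_def, ofPath_mul_comp, Quiver.Path.comp_nil, LinearMap.id_apply]
    · intro k _ hk
      rw [← mul_def, ofPath_mul_of_ne _ _ hk.symm]
    · simp
  exact congrArg (fun H => H a) h

protected theorem mul_one' (a : PathAlgebra K V) : a * 1 = a := by
  have h : (mulHom K V).flip 1 = LinearMap.id := by
    refine hom_ext fun i j p => ?_
    rw [one_def, map_sum, LinearMap.sum_apply, Finset.sum_eq_single i]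
    · rw [LinearMap.flip_apply, ← mul_def, ofPath_mul_comp, Quiver.Path.nil_comp,
        LinearMap.id_apply]
    · intro k _ hk
      rw [LinearMap.flip_apply, ← mul_def, ofPath_mul_of_ne _ _ hk]
    · simp
  exact congrArg (fun H => H a) h

instance : Ring (PathAlgebra K V) :=
  { (inferInstance : AddCommGroup (PathAlgebra K V)),
    (inferInstance : Mul (PathAlgebra K V)),
    (inferInstance : One (PathAlgebra K V)) with
    left_distrib := fun a b c => by simp [mul_def]
    right_distrib := fun a b c => by simp [mul_def]
    zero_mul := fun a => by simp [mul_def]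
    mul_zero := fun a => by simp [mul_def]
    mul_assoc := PathAlgebra.mul_assoc'
    one_mul := PathAlgebra.one_mul'
    mul_one := PathAlgebra.mul_one' }

instance : Algebra K (PathAlgebra K V) :=
  Algebra.ofModule (fun r a b => by simp [mul_def]) (fun r a b => by simp [mul_def])

variable (K) in
/-- The primitive idempotent of the path algebra given by the path of length `0` at `i`. -/
def idem (i : V) : PathAlgebra K V := ofPath K (Quiver.Path.nil : Quiver.Path i i)

variable (K V) in
/-- The `m`-th power of the arrow ideal: the span of the paths of length at least `m`. -/
def arrowPow (m : ℕ) : Submodule K (PathAlgebra K V) :=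
  Submodule.span K {a | ∃ (i j : V) (p : Quiver.Path i j), m ≤ p.length ∧ a = ofPath K p}

end PathAlgebra

open PathAlgebra

/-! ### Radical layers, for modules over an arbitrary ring -/

/-- `J ^ l M`, where `J` is the Jacobson radical. -/
def radPow (A : Type x) (M : Type*) [Ring A] [AddCommGroup M] [Module A M] (l : ℕ) :
    Submodule A M :=
  (Ring.jacobson A) ^ l • (⊤ : Submodule A M)

/-- The radical layer `J ^ l M / J ^ (l + 1) M`, as a submodule of `M / J ^ (l + 1) M`. -/
def radLayer (A : Type x) (M : Type*) [Ring A] [AddCommGroup M] [Module A M] (l : ℕ) :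
    Submodule A (M ⧸ radPow A M (l + 1)) :=
  (radPow A M l).map (radPow A M (l + 1)).mkQ

/-! ### The Zariski topology on Grassmannians -/

/-- The Zariski topology on the disjoint union over `k` of the classical Grassmannians `Gr(k, W)`
of `k`-dimensional subspaces of a finite dimensional vector space `W`.

Alternating `k`-forms `ω` on `W` are the linear forms on the exterior power `⋀ᵏ W`, so their values
`ω (c₁, …, c_k)` on a basis of a subspace `C` are its homogeneous coordinates under the Plücker
embedding.  The basic open sets are the sets of `C ∈ Gr(k, W)` at which a given homogeneous
polynomial in these coordinates does not vanish. -/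
@[reducible] def zariskiGr (K : Type w) (W : Type*) [Field K] [AddCommGroup W] [Module K W] :
    TopologicalSpace (Submodule K W) :=
  TopologicalSpace.generateFrom
    {U | ∃ (k n : ℕ) (F : MvPolynomial (W [⋀^Fin k]→ₗ[K] K) K), F.IsHomogeneous n ∧
      U = {C : Submodule K W | ∃ c : Module.Basis (Fin k) K C,
        MvPolynomial.eval (fun ω => ω fun j => (c j : W)) F ≠ 0}}

/-- `X` and `Y` being sets of `A`-submodules of `W`, viewed as points of Grassmannians of the
`K`-space `W`: the set `Y` is contained in `X` and is open in `X` with respect to the Zariski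
topology. -/
def IsZariskiOpenIn (K : Type w) {A : Type x} {W : Type*} [Field K] [Ring A] [Algebra K A]
    [AddCommGroup W] [Module K W] [Module A W] [IsScalarTower K A W]
    (Y X : Set (Submodule A W)) : Prop :=
  ∃ U : Set (Submodule K W), (zariskiGr K W).IsOpen U ∧ Y = {C ∈ X | C.restrictScalars K ∈ U}

/-- For a family of vectors `v` in a subspace `W₀` of `W`: the big Schubert cell of the subspaces
`C` of `W₀` such that `W₀` is the direct sum of `C` and of the lines spanned by the `v k`. -/
def schubertCell {K : Type w} {W κ : Type*} [Field K] [AddCommGroup W] [Module K W]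
    (W₀ : Submodule K W) (v : κ → W) : Set (Submodule K W) :=
  {C | LinearIndependent K v ∧ C ⊓ Submodule.span K (Set.range v) = ⊥ ∧
    C ⊔ Submodule.span K (Set.range v) = W₀}

/-! ### Algebras `Λ = KΓ / I` and their modules -/

section Algebras

variable {K : Type w} {V : Type u} [Field K] [Fintype V] [Quiver.{v} V]

/-- Admissible ideals of the path algebra. -/
def IsAdmissible (I : Ideal (PathAlgebra K V)) : Prop :=
  I.restrictScalars K ≤ arrowPow K V 2 ∧ ∃ m : ℕ, arrowPow K V m ≤ I.restrictScalars K

variable (I : Ideal (PathAlgebra K V)) [I.IsTwoSided]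

/-- `Λ = KΓ / I`. -/
abbrev BoundAlg : Type (max u v w) := PathAlgebra K V ⧸ I

/-- The idempotent `e_i` of `Λ`. -/
def vert (i : V) : BoundAlg I := Ideal.Quotient.mk I (idem K i)

/-- The simple module `S_i = Λ e_i / J e_i`. -/
abbrev SimpleMod (i : V) : Type (max u v w) :=
  (Ideal.span {vert I i} : Ideal (BoundAlg I)) ⧸
    (Ring.jacobson (BoundAlg I) • (⊤ : Submodule (BoundAlg I)
      (Ideal.span {vert I i} : Ideal (BoundAlg I))))

/-- The semisimple module with dimension vector `m`, that is, the direct sum of the `S_i ^ (m i)`.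
Semisimple modules are identified with their dimension vectors. -/
abbrev SemisimpleMod (m : V → ℕ) : Type (max u v w) := (i : V) → Fin (m i) → SimpleMod I i

section Modules

variable (M : Type*) [AddCommGroup M] [Module K M] [Module (BoundAlg I) M]
  [IsScalarTower K (BoundAlg I) M]

/-- `M` has dimension vector `d`: the subspace `e_i M` has dimension `d i` for each vertex `i`. -/
def HasDimVec (d : V → ℕ) : Prop :=
  ∀ i, Module.finrank K (LinearMap.range (Algebra.lsmul K K M (vert I i))) = d i

/-- `M` has top `⨁ S_i ^ (t i)`. -/
def HasTop (M : Type*) [AddCommGroup M] [Module (BoundAlg I) M] (t : V → ℕ) : Prop :=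
  Nonempty ((M ⧸ (Ring.jacobson (BoundAlg I) • ⊤ : Submodule (BoundAlg I) M)) ≃ₗ[BoundAlg I]
    SemisimpleMod I t)

/-- `M` has radical layering `S = (S_0, …, S_L)`. -/
def HasRadLayering (M : Type*) [AddCommGroup M] [Module (BoundAlg I) M] {L : ℕ}
    (S : Fin (L + 1) → V → ℕ) : Prop :=
  ∀ l : Fin (L + 1), Nonempty (radLayer (BoundAlg I) M l ≃ₗ[BoundAlg I] SemisimpleMod I (S l))

/-- A full sequence of top elements of `M`: a family of elements of `M`, each of them lying outside
`J M` and normed by some `e_i`, which generates `M` and is linearly independent modulo `J M`. -/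
structure IsFullTopSequence {κ : Type*} (x : κ → M) : Prop where
  normed : ∀ k, ∃ i, vert I i • x k = x k
  notMem : ∀ k, x k ∉ (Ring.jacobson (BoundAlg I) • ⊤ : Submodule (BoundAlg I) M)
  span_eq_top : Submodule.span (BoundAlg I) (Set.range x) = ⊤
  linearIndependent : LinearIndependent K fun k =>
    (Ring.jacobson (BoundAlg I) • ⊤ : Submodule (BoundAlg I) M).mkQ (x k)

end Modules

/-! ### Distinguished projective modules and skeleta -/

/-- Index set for the distinguished top elements `z_r` of the distinguished projective cover of
`⨁ S_i ^ (m i)`; the element `z_r` is normed by the idempotent at the vertex `r.1`. -/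
abbrev TopIdx (m : V → ℕ) : Type u := Σ i : V, Fin (m i)

/-- The distinguished projective cover `Q = ⨁_r Λ z_r` of the semisimple module `⨁ S_i ^ (m i)`,
where `Λ z_r = Λ e(r)`. -/
abbrev ProjMod (m : V → ℕ) : Type (max u v w) :=
  (r : TopIdx m) → (Ideal.span {vert I r.1} : Ideal (BoundAlg I))

open Classical in
/-- The distinguished top element `z_r` of `Q`. -/
def topElt (m : V → ℕ) (r : TopIdx m) : ProjMod I m :=
  Pi.single r ⟨vert I r.1, Ideal.subset_span rfl⟩

variable (K) in
/-- The projective `KΓ`-module `Q̂ = ⨁_r KΓ ẑ_r` covering `Q`. -/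
abbrev ProjHat (m : V → ℕ) : Type (max u v w) :=
  (r : TopIdx m) → (Ideal.span {idem K r.1} : Ideal (PathAlgebra K V))

variable (K) in
open Classical in
/-- The distinguished top element `ẑ_r` of `Q̂`. -/
def hatElt (m : V → ℕ) (r : TopIdx m) : ProjHat K m :=
  Pi.single r ⟨idem K r.1, Ideal.subset_span rfl⟩

/-- A path `p ẑ_r` in `Q̂`: an index `r` together with a path `p` starting in the vertex `e(r)`. -/
structure HatPath (m : V → ℕ) where
  /-- the index `r` -/
  idx : TopIdx m
  /-- the endpoint -/
  target : V
  /-- the path `p` -/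
  path : Quiver.Path idx.1 target

/-- The path `ẑ_r` of length zero. -/
def HatPath.nil {m : V → ℕ} (r : TopIdx m) : HatPath m := ⟨r, r.1, Quiver.Path.nil⟩

variable (K) in
/-- The path `p ẑ_r`, as an element of `Q̂`. -/
def HatPath.elt {m : V → ℕ} (p : HatPath m) : ProjHat K m := ofPath K p.path • hatElt K m p.idx

/-- The element `p z_r` of `Q`. -/
def HatPath.toProj {m : V → ℕ} (p : HatPath m) : ProjMod I m :=
  (Ideal.Quotient.mk I (ofPath K p.path)) • topElt I m p.idx

/-- `σ` is an abstract skeleton in `Q̂` with top `T = ⨁ S_i ^ (t i)`: it consists of paths of length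
at most `L`, is closed under initial subpaths, and the `z_r` with `ẑ_r ∈ σ` are such that the sum
of the corresponding `Λ z_r ≅ Λ e(r)` is a projective cover of `T`, that is, exactly `t i` of them
are normed by `e_i`. -/
structure IsSkeleton {m : V → ℕ} (L : ℕ) (t : V → ℕ) (σ : Set (HatPath m)) : Prop where
  length_le : ∀ p ∈ σ, p.path.length ≤ L
  tops : ∀ i, {r : TopIdx m | HatPath.nil r ∈ σ ∧ r.1 = i}.encard = t i
  initial : ∀ (r : TopIdx m) (j k : V) (p₁ : Quiver.Path r.1 j) (p₂ : Quiver.Path j k),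
    (⟨r, k, p₁.comp p₂⟩ : HatPath m) ∈ σ → (⟨r, j, p₁⟩ : HatPath m) ∈ σ

/-- `σ_l`, the set of paths of length `l` in `σ`. -/
def layer {m : V → ℕ} (σ : Set (HatPath m)) (l : ℕ) : Set (HatPath m) :=
  {p ∈ σ | p.path.length = l}

/-- `σ` is compatible with the sequence `S`: for all `l` and `i`, the number of paths in `σ_l` ending
in the vertex `i` is the multiplicity of `S_i` in the `l`-th entry of `S`. -/
def Compatible {m : V → ℕ} {L : ℕ} (S : Fin (L + 1) → V → ℕ) (σ : Set (HatPath m)) : Prop :=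
  ∀ (l : Fin (L + 1)) (i : V), {p ∈ layer σ l | p.target = i}.encard = S l i

/-- The abstract skeleton `σ` is a skeleton of `M` relative to the sequence `x` of top elements,
which is indexed by the `r` with `ẑ_r ∈ σ`. -/
def IsSkeletonRel (M : Type*) [AddCommGroup M] [Module K M] [Module (BoundAlg I) M]
    [IsScalarTower K (BoundAlg I) M] {m : V → ℕ} (L : ℕ) (σ : Set (HatPath m))
    (x : {r : TopIdx m // HatPath.nil r ∈ σ} → M) : Prop :=
  IsFullTopSequence I M x ∧
    ∃ f : ProjHat K m →ₛₗ[Ideal.Quotient.mk I] M, Function.Surjective f ∧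
      (∀ r, f (hatElt K m r.1) = x r) ∧
      ∀ l ≤ L,
        LinearIndependent K (fun p : layer σ l =>
          (radPow (BoundAlg I) M (l + 1)).mkQ (f (p.1.elt K))) ∧
        Submodule.span K (Set.range fun p : layer σ l =>
          (radPow (BoundAlg I) M (l + 1)).mkQ (f (p.1.elt K))) =
          (radLayer (BoundAlg I) M l).restrictScalars K

/-- `σ` is a distinguished skeleton of `Q / C`. -/
def IsDistinguished {m : V → ℕ} (L : ℕ) (σ : Set (HatPath m))
    (C : Submodule (BoundAlg I) (ProjMod I m)) : Prop :=
  IsSkeletonRel I (ProjMod I m ⧸ C) L σ fun r => C.mkQ (topElt I m r.1)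

/-- `S = (S_0, …, S_L)` is a semisimple sequence with dimension vector `d` and top `S_0`; here `P` is
the distinguished projective cover of `S_0`. -/
structure IsSemisimpleSequence {L : ℕ} (d : V → ℕ) (S : Fin (L + 1) → V → ℕ) : Prop where
  sum_eq : ∀ i, ∑ l, S l i = d i
  le_layer : ∀ l, ∃ f : SemisimpleMod I (S l) →ₗ[BoundAlg I]
    radLayer (BoundAlg I) (ProjMod I (S 0)) l, Function.Injective f

/-! ### The small varieties

Here `P = ProjMod I t` is the distinguished projective cover of `T = ⨁ S_i ^ (t i)`. -/

/-- `Grass^T_n` for a natural number `n`: the `Λ`-submodules of `JP` of dimension `dim P - n`. -/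
def smallGrassTotal (t : V → ℕ) (n : ℕ) : Set (Submodule (BoundAlg I) (ProjMod I t)) :=
  {C | C ≤ Ring.jacobson (BoundAlg I) • ⊤ ∧
    Module.finrank K C + n = Module.finrank K (ProjMod I t)}

/-- `Grass^T_d` for a dimension vector `d`: the points `C` of `Grass^T_{|d|}` such that `P / C` has
dimension vector `d`. -/
def smallGrassTop (t d : V → ℕ) : Set (Submodule (BoundAlg I) (ProjMod I t)) :=
  {C ∈ smallGrassTotal I t (∑ i, d i) | HasDimVec I (ProjMod I t ⧸ C) d}

/-- `Grass(S)`. -/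
def smallGrass {L : ℕ} (d : V → ℕ) (S : Fin (L + 1) → V → ℕ) :
    Set (Submodule (BoundAlg I) (ProjMod I (S 0))) :=
  {C ∈ smallGrassTop I (S 0) d | HasRadLayering I (ProjMod I (S 0) ⧸ C) S}

/-- `Grass(σ)`. -/
def smallGrassSkel (L : ℕ) (t d : V → ℕ) (σ : Set (HatPath t)) :
    Set (Submodule (BoundAlg I) (ProjMod I t)) :=
  {C ∈ smallGrassTotal I t (∑ i, d i) | IsDistinguished I L σ C}

/-- `Schu(σ)`: the intersection of `Grass^T_d` with the big Schubert cell of the complements, in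
`JP`, of the span of the `p z_r` where `p ẑ_r ∈ σ` has positive length. -/
def smallSchu (t d : V → ℕ) (σ : Set (HatPath t)) :
    Set (Submodule (BoundAlg I) (ProjMod I t)) :=
  {C ∈ smallGrassTop I t d | C.restrictScalars K ∈
    schubertCell ((Ring.jacobson (BoundAlg I) • ⊤ :
        Submodule (BoundAlg I) (ProjMod I t)).restrictScalars K)
      (fun p : {p : HatPath t // p ∈ σ ∧ 0 < p.path.length} => p.1.toProj I)}

/-! ### The big varieties

Here `𝐏 = ProjMod I d` is the distinguished projective cover of `⨁ S_i ^ (d i)`. -/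

/-- `GRASS_d(Λ)`: the submodules `C` of `𝐏` of dimension `dim 𝐏 - |d|` such that `𝐏 / C` has dimension
vector `d`. -/
def bigGrassDim (d : V → ℕ) : Set (Submodule (BoundAlg I) (ProjMod I d)) :=
  {C | Module.finrank K C + ∑ i, d i = Module.finrank K (ProjMod I d) ∧
    HasDimVec I (ProjMod I d ⧸ C) d}

/-- `GRASS^T_d`, where `T = ⨁ S_i ^ (t i)`. -/
def bigGrassTop (t d : V → ℕ) : Set (Submodule (BoundAlg I) (ProjMod I d)) :=
  {C ∈ bigGrassDim I d | HasTop I (ProjMod I d ⧸ C) t}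

/-- `GRASS(S)`. -/
def bigGrass {L : ℕ} (d : V → ℕ) (S : Fin (L + 1) → V → ℕ) :
    Set (Submodule (BoundAlg I) (ProjMod I d)) :=
  {C ∈ bigGrassDim I d | HasRadLayering I (ProjMod I d ⧸ C) S}

/-- `GRASS(σ)`. -/
def bigGrassSkel (L : ℕ) (d : V → ℕ) (σ : Set (HatPath d)) :
    Set (Submodule (BoundAlg I) (ProjMod I d)) :=
  {C ∈ bigGrassDim I d | IsDistinguished I L σ C}

/-- `SCHU(σ)`: the intersection of `GRASS_d(Λ)` with the big Schubert cell of the complements, in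
`𝐏`, of the span of the `p z_r` where `p ẑ_r ∈ σ`. -/
def bigSchu (d : V → ℕ) (σ : Set (HatPath d)) : Set (Submodule (BoundAlg I) (ProjMod I d)) :=
  {C ∈ bigGrassDim I d | C.restrictScalars K ∈
    schubertCell (⊤ : Submodule K (ProjMod I d)) (fun p : σ => p.1.toProj I)}

end Algebras

end

/-! # Charts of the strata of modules with fixed radical layering

Let `C` be a submodule of `Q = P` or `Q = 𝐏`, let `σ` be a skeleton compatible with `S`, and consider
the elements `p z_r + C` of `Q / C` with `p ẑ_r ∈ σ`. The element belonging to a path of length `l`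
lies in `J ^ l (Q / C)`. Compatibility says that `σ` has as many paths of length `l` as the dimension
of `S_l`. So if `Q / C` has radical layering `S` and is spanned by this family, then counting
dimensions from the socle end shows that the family is a basis of `Q / C` in which every
`J ^ l (Q / C)` is spanned by the elements of level at least `l` (`adapted_of_span_eq_top`); hence it
induces bases of all radical layers. Thus `σ` is a distinguished skeleton of `Q / C` if and only if
`Q / C` has radical layering `S` and the `p z_r + C` span it (`isDistinguished_iff`), that is, if and
only if `C` lies in the stratum and in the big Schubert cell. The cell is open, being given by the
non-vanishing of one Plücker coordinate (`exists_isOpen_schubertCell`). Charts cover the strata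
because bases of the radical layers can be chosen one after the other among the multiples by arrows
of the basis elements of the previous layer (`exists_isDistinguished`). The translation between
dimensions, normed bases and semisimple modules rests on the description of `J` as the span of the
paths of positive length (`mem_jacobson_iff_mem_pathSpan`).

For the failure of openness in the larger varieties, let `Γ` be the quiver with arrows `a : 1 ⟶ 2`,
`b : 2 ⟶ 3` and `c : 1 ⟶ 3`, and let `I = 0`, `d = (1, 1, 1)` and `S = (S_1, S_2 ⊕ S_3, 0)`. In the
small scenario, the points `C_t = K (b a + t c) z` for `t ∈ K` form a curve in the varieties of
submodules; in the big scenario, the remaining summands of `𝐏` are added to `C_t`. In `Q / C_0` the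
path `b a` vanishes and the radical layering is `S`, while for `t ≠ 0` the element
`c z = - t⁻¹ b a z` has moved into `J ^ 2 (Q / C_t)`. So a chart containing `C_0` contains no other
point of the curve. But `C_t` is the translate of `C_0` by `1 + t N` for a nilpotent `N`, hence its
Plücker coordinates are polynomials in `t`, and an open set containing `C_0` contains all but
finitely many `C_t` (`finite_map_notMem_of_isOpen`). -/

noncomputable section

open PathAlgebra

/-! ### Powers of the radical, and the radical in terms of paths -/

/-- The ideals of a noncommutative ring do not form a monoid in Mathlib, so that the powers of the
radical are those of `Submodule`. -/
theorem pow_zero_smul {A M : Type*} [Ring A] [AddCommGroup M] [Module A M] (J : Ideal A)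
    (N : Submodule A M) : J ^ 0 • N = N := by
  rw [Submodule.pow_zero]
  exact Submodule.one_smul _

theorem pow_succ_smul {A M : Type*} [Ring A] [AddCommGroup M] [Module A M] (J : Ideal A)
    (N : Submodule A M) (l : ℕ) : J ^ (l + 1) • N = J • J ^ l • N := by
  rcases Nat.eq_zero_or_pos l with rfl | hl
  · rw [Submodule.pow_succ, ← smul_eq_mul, Submodule.smul_assoc, pow_zero_smul, pow_zero_smul]
  · rw [Submodule.pow_succ' _ hl.ne', ← smul_eq_mul, Submodule.smul_assoc]

theorem radPow_zero (A : Type*) [Ring A] (M : Type*) [AddCommGroup M] [Module A M] :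
    radPow A M 0 = ⊤ := pow_zero_smul _ _

theorem radPow_succ (A : Type*) [Ring A] (M : Type*) [AddCommGroup M] [Module A M] (l : ℕ) :
    radPow A M (l + 1) = Ring.jacobson A • radPow A M l := pow_succ_smul _ _ _

theorem radPow_one (A : Type*) [Ring A] (M : Type*) [AddCommGroup M] [Module A M] :
    radPow A M 1 = Ring.jacobson A • ⊤ := by
  rw [radPow_succ, radPow_zero]

theorem radPow_succ_le (A : Type*) [Ring A] (M : Type*) [AddCommGroup M] [Module A M] (l : ℕ) :
    radPow A M (l + 1) ≤ radPow A M l := by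
  rw [radPow_succ]
  exact Submodule.smul_le.2 fun r _ n hn => Submodule.smul_mem _ r hn

theorem radPow_antitone (A : Type*) [Ring A] (M : Type*) [AddCommGroup M] [Module A M] :
    Antitone (radPow A M) :=
  antitone_nat_of_succ_le (radPow_succ_le A M)

theorem radPow_map {A M N : Type*} [Ring A] [AddCommGroup M] [Module A M] [AddCommGroup N]
    [Module A N] (f : M →ₗ[A] N) (hf : Function.Surjective f) (l : ℕ) :
    (radPow A M l).map f = radPow A N l := by
  rw [radPow, radPow, Submodule.map_smul'', Submodule.map_top, LinearMap.range_eq_top.2 hf]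

section BoundQuiver

variable {K : Type w} {V : Type u} [Field K] [Fintype V] [Quiver.{v} V]
variable (I : Ideal (PathAlgebra K V)) [I.IsTwoSided]

/-- The residue class in `Λ = KΓ / I` of a path of `Γ`. -/
def pathClass {i j : V} (p : Quiver.Path i j) : BoundAlg I := Ideal.Quotient.mk I (ofPath K p)

theorem pathClass_nil (i : V) : pathClass I (Quiver.Path.nil : Quiver.Path i i) = vert I i := rfl

theorem pathClass_mul_comp {i j k : V} (p : Quiver.Path j k) (q : Quiver.Path i j) :
    pathClass I p * pathClass I q = pathClass I (q.comp p) := by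
  rw [pathClass, pathClass, ← map_mul, ofPath_mul_comp, pathClass]

theorem pathClass_mul_of_ne {i j k l : V} (p : Quiver.Path i j) (q : Quiver.Path k l)
    (h : l ≠ i) : pathClass I p * pathClass I q = 0 := by
  rw [pathClass, pathClass, ← map_mul, ofPath_mul_of_ne _ _ h, map_zero]

theorem vert_mul_pathClass {i j : V} (p : Quiver.Path i j) :
    vert I j * pathClass I p = pathClass I p := pathClass_mul_comp I Quiver.Path.nil p

theorem pathClass_mul_vert {i j : V} (p : Quiver.Path i j) :
    pathClass I p * vert I i = pathClass I p := by
  rw [← pathClass_nil, pathClass_mul_comp, Quiver.Path.nil_comp]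

theorem pathClass_mul_vert_of_ne {i j k : V} (p : Quiver.Path i j) (h : k ≠ i) :
    pathClass I p * vert I k = 0 := pathClass_mul_of_ne I p Quiver.Path.nil h

theorem vert_mul_self (i : V) : vert I i * vert I i = vert I i := pathClass_mul_vert I _

theorem vert_mul_of_ne {i j : V} (h : i ≠ j) : vert I i * vert I j = 0 :=
  pathClass_mul_vert_of_ne I _ h.symm

/-- The span in `Λ` of the residue classes of the paths of length at least `m`. -/
def pathSpan (m : ℕ) : Submodule K (BoundAlg I) :=
  Submodule.span K {a | ∃ (i j : V) (p : Quiver.Path i j), m ≤ p.length ∧ a = pathClass I p}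

variable {I} in
theorem pathClass_mem_pathSpan {m : ℕ} {i j : V} (p : Quiver.Path i j) (h : m ≤ p.length) :
    pathClass I p ∈ pathSpan I m := Submodule.subset_span ⟨i, j, p, h, rfl⟩

theorem map_arrowPow (m : ℕ) :
    (arrowPow K V m).map (Ideal.Quotient.mkₐ K I).toLinearMap = pathSpan I m := by
  rw [arrowPow, Submodule.map_span, pathSpan]
  congr 1
  ext a
  constructor
  · rintro ⟨_, ⟨i, j, p, h, rfl⟩, rfl⟩
    exact ⟨i, j, p, h, rfl⟩
  · rintro ⟨i, j, p, h, rfl⟩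
    exact ⟨_, ⟨i, j, p, h, rfl⟩, rfl⟩

theorem pathSpan_zero : pathSpan I 0 = ⊤ := by
  have h : arrowPow K V 0 = ⊤ := by
    refine eq_top_iff.2 fun a _ => ?_
    have h2 : (Submodule.mkQ (arrowPow K V 0)) = 0 := by
      refine hom_ext fun i j p => ?_
      rw [LinearMap.zero_apply, Submodule.mkQ_apply, Submodule.Quotient.mk_eq_zero]
      exact Submodule.subset_span ⟨i, j, p, Nat.zero_le _, rfl⟩
    have h3 := LinearMap.congr_fun h2 a
    rwa [LinearMap.zero_apply, Submodule.mkQ_apply, Submodule.Quotient.mk_eq_zero] at h3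
  rw [← map_arrowPow, h, Submodule.map_top, LinearMap.range_eq_top]
  exact Ideal.Quotient.mk_surjective

theorem pathSpan_mul_le (m n : ℕ) : pathSpan I m * pathSpan I n ≤ pathSpan I (m + n) := by
  rw [pathSpan, pathSpan, Submodule.span_mul_span, Submodule.span_le]
  rintro _ ⟨_, ⟨i, j, p, hp, rfl⟩, _, ⟨k, l, q, hq, rfl⟩, rfl⟩
  by_cases h : l = i
  · subst h
    simp only [pathClass_mul_comp]
    exact pathClass_mem_pathSpan _ (by rw [Quiver.Path.length_comp]; omega)
  · simp only [pathClass_mul_of_ne I p q h]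
    exact Submodule.zero_mem _

theorem pow_mem_pathSpan {a : BoundAlg I} (ha : a ∈ pathSpan I 1) (m : ℕ) :
    a ^ m ∈ pathSpan I m := by
  induction m with
  | zero => rw [pathSpan_zero]; trivial
  | succ m ih =>
    rw [pow_succ]
    exact pathSpan_mul_le I m 1 (Submodule.mul_mem_mul ih ha)

theorem top_le_span_vert_sup :
    ⊤ ≤ Submodule.span K (Set.range (vert I)) ⊔ pathSpan I 1 := by
  rw [← pathSpan_zero I, pathSpan, Submodule.span_le]
  rintro _ ⟨i, j, p, -, rfl⟩
  cases p with
  | nil => exact Submodule.mem_sup_left (Submodule.subset_span ⟨i, rfl⟩)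
  | cons p e =>
    exact Submodule.mem_sup_right (pathClass_mem_pathSpan _ (by simp))

variable {I}

theorem exists_pathSpan_eq_bot (hI : IsAdmissible I) : ∃ m, pathSpan I m = ⊥ := by
  obtain ⟨m, hm⟩ := hI.2
  refine ⟨m, ?_⟩
  rw [← map_arrowPow, eq_bot_iff]
  rintro _ ⟨a, ha, rfl⟩
  exact Ideal.Quotient.eq_zero_iff_mem.2 (hm ha)

theorem vert_ne_zero (hI : IsAdmissible I) (i : V) : vert I i ≠ 0 := by
  classical
  intro h
  have h1 : idem K i ∈ arrowPow K V 2 := hI.1 (Ideal.Quotient.eq_zero_iff_mem.1 h)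
  let f : PathAlgebra K V →ₗ[K] K := Finsupp.lapply (⟨i, i, Quiver.Path.nil⟩ : QPath V)
  have h2 : arrowPow K V 2 ≤ LinearMap.ker f := by
    refine Submodule.span_le.2 ?_
    rintro _ ⟨k, l, p, hp, rfl⟩
    refine Finsupp.single_eq_of_ne ?_
    intro h
    cases h
    simp at hp
  have h3 : f (idem K i) = 1 := Finsupp.single_eq_same
  rw [LinearMap.mem_ker.1 (h2 h1)] at h3
  exact zero_ne_one h3

theorem vert_notMem_jacobson (hI : IsAdmissible I) (i : V) :
    vert I i ∉ Ring.jacobson (BoundAlg I) := by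
  intro h
  rw [← Ideal.jacobson_bot, Ideal.mem_jacobson_iff] at h
  obtain ⟨z, hz⟩ := h (-1)
  rw [Ideal.mem_bot] at hz
  -- multiplying the relation `z * (1 - e) = 1` by `e` on the right
  have h2 : (z * (-1) * vert I i + z - 1) * vert I i = - vert I i := by
    have h3 := vert_mul_self I i
    rw [sub_mul, add_mul, mul_assoc _ (vert I i), h3]
    simp
  rw [hz, zero_mul] at h2
  exact vert_ne_zero hI i (neg_eq_zero.1 h2.symm)

/-- For an admissible ideal, the Jacobson radical of `Λ` is spanned by the paths of positive length:
their span is a nilpotent ideal, and `Λ` modulo this ideal is a product of copies of `K`. -/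
theorem mem_jacobson_iff_mem_pathSpan (hI : IsAdmissible I) (a : BoundAlg I) :
    a ∈ Ring.jacobson (BoundAlg I) ↔ a ∈ pathSpan I 1 := by
  have key : ∀ a ∈ pathSpan I 1, a ∈ Ring.jacobson (BoundAlg I) := by
    intro a ha
    rw [← Ideal.jacobson_bot, Ideal.mem_jacobson_iff]
    intro y
    have h1 : y * a ∈ pathSpan I 1 := by
      have hy : y ∈ pathSpan I 0 := by rw [pathSpan_zero]; trivial
      simpa using pathSpan_mul_le I 0 1 (Submodule.mul_mem_mul hy ha)
    have h2 : IsNilpotent (y * a) := by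
      obtain ⟨m, hm⟩ := exists_pathSpan_eq_bot hI
      refine ⟨m, ?_⟩
      have := pow_mem_pathSpan I h1 m
      rwa [hm, Submodule.mem_bot] at this
    obtain ⟨z, hz⟩ := h2.isUnit_one_add.exists_left_inv
    refine ⟨z, ?_⟩
    rw [Ideal.mem_bot, ← hz]
    noncomm_ring
  refine ⟨fun ha => ?_, key a⟩
  -- modulo the arrows, `a` is a combination of the `e_i`; multiplying by `e_i` isolates its
  -- `i`-th coefficient, which vanishes as `e_i` is not in the radical
  obtain ⟨s, hs, r, hr, rfl⟩ :=
    Submodule.mem_sup.1 (top_le_span_vert_sup I (Submodule.mem_top (x := a)))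
  have hs2 : s ∈ Ring.jacobson (BoundAlg I) := by
    simpa using sub_mem ha (key r hr)
  obtain ⟨c, rfl⟩ := (Submodule.mem_span_range_iff_exists_fun K).1 hs
  have hc : ∀ i, c i = 0 := by
    intro i
    by_contra hne
    have h1 : vert I i * ∑ j, c j • vert I j = c i • vert I i := by
      rw [Finset.mul_sum, Finset.sum_eq_single i]
      · rw [mul_smul_comm, vert_mul_self]
      · intro j _ hj
        rw [mul_smul_comm, vert_mul_of_ne I hj.symm, smul_zero]
      · simp
    have h2 : c i • vert I i ∈ Ring.jacobson (BoundAlg I) := h1 ▸ Ideal.mul_mem_left _ _ hs2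
    have h3 := Submodule.smul_of_tower_mem _ (c i)⁻¹ h2
    rw [smul_smul, inv_mul_cancel₀ hne, one_smul] at h3
    exact vert_notMem_jacobson hI i h3
  simpa [hc] using hr

variable {M : Type*} [AddCommGroup M] [Module K M] [Module (BoundAlg I) M]
  [IsScalarTower K (BoundAlg I) M]

theorem pathClass_mem_jacobson (hI : IsAdmissible I) {i j : V} (p : Quiver.Path i j)
    (hp : 0 < p.length) : pathClass I p ∈ Ring.jacobson (BoundAlg I) :=
  (mem_jacobson_iff_mem_pathSpan hI _).2 (pathClass_mem_pathSpan p hp)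

/-- Multiplying by the Jacobson radical amounts to multiplying by the arrows. -/
theorem jacobson_smul_eq_span (hI : IsAdmissible I) (N : Submodule (BoundAlg I) M) :
    (Ring.jacobson (BoundAlg I) • N).restrictScalars K =
      Submodule.span K {x | ∃ (i j : V) (e : i ⟶ j), ∃ n ∈ N, x = pathClass I e.toPath • n} := by
  refine le_antisymm ?_ (Submodule.span_le.2 ?_)
  · intro x hx
    rw [Submodule.restrictScalars_mem] at hx
    refine Submodule.smul_induction_on (p := fun x => x ∈ Submodule.span K _) hx
      (fun r hr n hn => ?_) fun x y => add_mem
    rw [mem_jacobson_iff_mem_pathSpan hI] at hr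
    have hle : pathSpan I 1 ≤ (Submodule.span K {x | ∃ (i j : V) (e : i ⟶ j), ∃ n ∈ N,
        x = pathClass I e.toPath • n}).comap ((Algebra.lsmul K K M).toLinearMap.flip n) := by
      refine Submodule.span_le.2 ?_
      rintro _ ⟨i, j, p, hp, rfl⟩
      cases p with
      | nil => simp at hp
      | @cons k _ p e =>
        refine Submodule.subset_span ⟨k, j, e, pathClass I p • n, N.smul_mem _ hn, ?_⟩
        rw [smul_smul, pathClass_mul_comp]
        rfl
    exact hle hr
  · rintro _ ⟨i, j, e, n, hn, rfl⟩
    rw [SetLike.mem_coe, Submodule.restrictScalars_mem]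
    exact (Submodule.smul_mem_smul (pathClass_mem_jacobson hI e.toPath (by simp)) hn :)

theorem pathClass_smul_mem_radPow {M : Type*} [AddCommGroup M] [Module (BoundAlg I) M]
    (hI : IsAdmissible I) {i j : V} (p : Quiver.Path i j) (n : M) :
    pathClass I p • n ∈ radPow (BoundAlg I) M p.length := by
  induction p with
  | nil => rw [Quiver.Path.length_nil, radPow_zero]; trivial
  | cons p e ih =>
    rw [Quiver.Path.length_cons, radPow_succ]
    have h : pathClass I (p.cons e) = pathClass I e.toPath * pathClass I p := by
      rw [pathClass_mul_comp]; rfl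
    rw [h, mul_smul]
    exact Submodule.smul_mem_smul (pathClass_mem_jacobson hI _ (by simp)) ih

theorem radPow_eq_bot_of_nilpotencyClass {M : Type*} [AddCommGroup M] [Module (BoundAlg I) M]
    {L : ℕ} (hL : nilpotencyClass (Ring.jacobson (BoundAlg I)) = L + 1) :
    radPow (BoundAlg I) M (L + 1) = ⊥ := by
  have h : Ring.jacobson (BoundAlg I) ^ (L + 1) = 0 := by
    rw [← hL]
    refine Nat.sInf_mem (s := {k | Ring.jacobson (BoundAlg I) ^ k = 0}) ?_
    by_contra hne
    rw [Set.not_nonempty_iff_eq_empty] at hne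
    -- for a radical which is not nilpotent, `nilpotencyClass` would be `0`
    rw [nilpotencyClass, hne, Nat.sInf_empty] at hL
    omega
  rw [radPow, h]
  exact Submodule.bot_smul _

end BoundQuiver

/-! ### Semisimple modules and normed bases -/

section NormedFamilies

variable {K : Type w} {V : Type u} [Field K] [Fintype V] [Quiver.{v} V]
variable {I : Ideal (PathAlgebra K V)} [I.IsTwoSided]
variable {M : Type*} [AddCommGroup M] [Module K M] [Module (BoundAlg I) M]
  [IsScalarTower K (BoundAlg I) M]
variable {N : Type*} [AddCommGroup N] [Module K N] [Module (BoundAlg I) N]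
  [IsScalarTower K (BoundAlg I) N]

-- Shortcuts for instance search, which is slow on quotients of path algebras.
local instance : Ring (BoundAlg I) := inferInstance
local instance : Semiring (BoundAlg I) := inferInstance
local instance : AddCommGroup (BoundAlg I) := inferInstance
local instance (i : V) : AddCommGroup (SimpleMod I i) := inferInstance
local instance (i : V) : AddCommMonoid (SimpleMod I i) := inferInstance
local instance (i : V) : Module (BoundAlg I) (SimpleMod I i) := inferInstance
local instance (i : V) : Module K (SimpleMod I i) := inferInstance
local instance (m : V → ℕ) : AddCommGroup (SemisimpleMod I m) := inferInstance
local instance (m : V → ℕ) : AddCommMonoid (SemisimpleMod I m) := inferInstance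

theorem vert_smul_of_ne {M : Type*} [AddCommGroup M] [Module (BoundAlg I) M] {i j : V} {x : M}
    (hx : vert I i • x = x) (h : j ≠ i) : vert I j • x = 0 := by
  rw [← hx, smul_smul, vert_mul_of_ne I h, zero_smul]

theorem pathClass_smul_of_ne {M : Type*} [AddCommGroup M] [Module (BoundAlg I) M] {i j k : V}
    {x : M} (hx : vert I k • x = x) (p : Quiver.Path i j) (h : k ≠ i) :
    pathClass I p • x = 0 := by
  rw [← hx, smul_smul, pathClass_mul_vert_of_ne I p h, zero_smul]

theorem vert_smul_pathClass_smul {M : Type*} [AddCommGroup M] [Module (BoundAlg I) M] {i j : V}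
    (p : Quiver.Path i j) (x : M) : vert I j • pathClass I p • x = pathClass I p • x := by
  rw [smul_smul, vert_mul_pathClass]

/-- Between modules which are annihilated by the Jacobson radical, a linear map is a module
homomorphism as soon as it commutes with the idempotents `e_i`. -/
def homOfVert (hI : IsAdmissible I)
    (hM : ∀ a ∈ Ring.jacobson (BoundAlg I), ∀ x : M, a • x = 0)
    (hN : ∀ a ∈ Ring.jacobson (BoundAlg I), ∀ x : N, a • x = 0)
    (g : M →ₗ[K] N) (hg : ∀ i x, g (vert I i • x) = vert I i • g x) : M →ₗ[BoundAlg I] N where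
  toFun := g
  map_add' := map_add g
  map_smul' a x := by
    obtain ⟨s, hs, r, hr, rfl⟩ :=
      Submodule.mem_sup.1 (top_le_span_vert_sup I (Submodule.mem_top (x := a)))
    rw [← mem_jacobson_iff_mem_pathSpan hI] at hr
    obtain ⟨c, rfl⟩ := (Submodule.mem_span_range_iff_exists_fun K).1 hs
    simp only [RingHom.id_apply, add_smul, hM r hr, hN r hr, add_zero, Finset.sum_smul, map_sum,
      smul_assoc, map_smul, hg]

/-- The class of `e_i` spans the simple module `S_i`. -/
def simpleEquiv (hI : IsAdmissible I) (i : V) : K ≃ₗ[K] SimpleMod I i :=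
  LinearEquiv.ofBijective
    (LinearMap.toSpanSingleton K (SimpleMod I i)
      (Submodule.Quotient.mk ⟨vert I i, Ideal.subset_span rfl⟩)) <| by
    have hmem : ∀ x : (Ideal.span {vert I i} : Ideal (BoundAlg I)),
        x ∈ Ring.jacobson (BoundAlg I) • (⊤ : Submodule (BoundAlg I)
          (Ideal.span {vert I i} : Ideal (BoundAlg I))) →
        (x : BoundAlg I) ∈ pathSpan I 1 := by
      intro x hx
      rw [Submodule.mem_smul_top_iff] at hx
      refine Submodule.smul_induction_on (p := fun x => x ∈ pathSpan I 1) hx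
        (fun r hr n hn => ?_) fun x y => add_mem
      have hn : n ∈ pathSpan I 0 := by rw [pathSpan_zero]; trivial
      exact pathSpan_mul_le I 1 0
        (Submodule.mul_mem_mul ((mem_jacobson_iff_mem_pathSpan hI r).1 hr) hn)
    constructor
    · refine LinearMap.ker_eq_bot.1 (LinearMap.ker_toSpanSingleton K (x := _) ?_)
      intro h
      rw [Submodule.Quotient.mk_eq_zero] at h
      exact vert_notMem_jacobson hI i ((mem_jacobson_iff_mem_pathSpan hI _).2 (hmem _ h))
    · intro y
      obtain ⟨⟨y, hy⟩, rfl⟩ := Submodule.Quotient.mk_surjective _ y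
      obtain ⟨a, rfl⟩ := Ideal.mem_span_singleton'.1 hy
      obtain ⟨s, hs, r, hr, rfl⟩ :=
        Submodule.mem_sup.1 (top_le_span_vert_sup I (Submodule.mem_top (x := a)))
      rw [← mem_jacobson_iff_mem_pathSpan hI] at hr
      obtain ⟨c, rfl⟩ := (Submodule.mem_span_range_iff_exists_fun K).1 hs
      refine ⟨c i, ?_⟩
      rw [LinearMap.toSpanSingleton_apply, ← Submodule.Quotient.mk_smul, Submodule.Quotient.eq]
      have h : (c i • (⟨vert I i, Ideal.subset_span rfl⟩ :
            (Ideal.span {vert I i} : Ideal (BoundAlg I))) -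
          ⟨(∑ j, c j • vert I j + r) * vert I i, hy⟩) =
          (-r) • (⟨vert I i, Ideal.subset_span rfl⟩ :
            (Ideal.span {vert I i} : Ideal (BoundAlg I))) := by
        refine Subtype.ext ?_
        have h2 : (∑ j, c j • vert I j) * vert I i = c i • vert I i := by
          rw [Finset.sum_mul, Finset.sum_eq_single i]
          · rw [smul_mul_assoc, vert_mul_self]
          · intro j _ hj
            rw [smul_mul_assoc, vert_mul_of_ne I hj, smul_zero]
          · simp
        change c i • vert I i - (∑ j, c j • vert I j + r) * vert I i = (-r) * vert I i
        rw [add_mul, h2, neg_mul]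
        abel
      rw [h]
      exact Submodule.smul_mem_smul (neg_mem hr) trivial

theorem simpleEquiv_normed (hI : IsAdmissible I) (i : V) (c : K) :
    vert I i • simpleEquiv hI i c = simpleEquiv hI i c := by
  change vert I i • (c • (Submodule.Quotient.mk _ : SimpleMod I i)) = c • Submodule.Quotient.mk _
  rw [smul_comm, ← Submodule.Quotient.mk_smul]
  congr 2
  exact Subtype.ext (vert_mul_self I i)

/-- The basis of the semisimple module with dimension vector `m` consisting of the classes of the
idempotents. -/
def semisimpleBasis (hI : IsAdmissible I) (m : V → ℕ) :
    Module.Basis (TopIdx m) K (SemisimpleMod I m) :=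
  Pi.basis fun i => Module.Basis.ofEquivFun
    (LinearEquiv.piCongrRight fun _ : Fin (m i) => (simpleEquiv hI i).symm)

theorem semisimpleBasis_normed (hI : IsAdmissible I) (m : V → ℕ) (r : TopIdx m) :
    vert I r.1 • semisimpleBasis hI m r = semisimpleBasis hI m r := by
  classical
  rw [semisimpleBasis, Pi.basis_apply, ← Pi.single_smul]
  congr 1
  ext k
  simp only [Pi.smul_apply, Module.Basis.coe_ofEquivFun]
  exact simpleEquiv_normed hI _ _

theorem jacobson_smul_simple {i : V} {a : BoundAlg I}
    (ha : a ∈ Ring.jacobson (BoundAlg I)) (x : SimpleMod I i) : a • x = 0 := by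
  obtain ⟨y, rfl⟩ := Submodule.Quotient.mk_surjective _ x
  rw [← Submodule.Quotient.mk_smul, Submodule.Quotient.mk_eq_zero]
  exact Submodule.smul_mem_smul ha trivial

theorem jacobson_smul_semisimple {m : V → ℕ} {a : BoundAlg I}
    (ha : a ∈ Ring.jacobson (BoundAlg I)) (x : SemisimpleMod I m) : a • x = 0 := by
  ext i k
  exact jacobson_smul_simple ha _

theorem jacobson_smul_radLayer {A M : Type*} [Ring A] [AddCommGroup M] [Module A M] {l : ℕ}
    {a : A} (ha : a ∈ Ring.jacobson A) (x : radLayer A M l) : a • x = 0 := by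
  obtain ⟨_, y, hy, rfl⟩ := x
  refine Subtype.ext ?_
  change a • (radPow A M (l + 1)).mkQ y = 0
  rw [← map_smul, Submodule.mkQ_apply, Submodule.Quotient.mk_eq_zero, radPow_succ]
  exact Submodule.smul_mem_smul ha hy

/-- A basis of `M` consisting of normed elements, with `ν k` the vertex norming the `k`-th element,
computes the dimension vector of `M`. -/
theorem finrank_range_vert {κ : Type*} (b : Module.Basis κ K M) (ν : κ → V)
    (hb : ∀ k, vert I (ν k) • b k = b k) [Finite κ] (i : V) :
    Module.finrank K (LinearMap.range (Algebra.lsmul K K M (vert I i))) =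
      Nat.card {k // ν k = i} := by
  have := Fintype.ofFinite κ
  classical
  have h : LinearMap.range (Algebra.lsmul K K M (vert I i)) =
      Submodule.span K (Set.range fun k : {k // ν k = i} => b k) := by
    refine le_antisymm ?_ (Submodule.span_le.2 ?_)
    · rw [LinearMap.range_eq_map, ← b.span_eq, Submodule.map_span, Submodule.span_le]
      rintro _ ⟨_, ⟨k, rfl⟩, rfl⟩
      change vert I i • b k ∈ _
      by_cases hk : ν k = i
      · subst hk
        rw [hb k]
        exact Submodule.subset_span ⟨⟨k, rfl⟩, rfl⟩
      · rw [vert_smul_of_ne (hb k) (Ne.symm hk)]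
        exact Submodule.zero_mem _
    · rintro _ ⟨⟨k, rfl⟩, rfl⟩
      exact ⟨b k, hb k⟩
  rw [h, finrank_span_eq_card, Nat.card_eq_fintype_card]
  exact b.linearIndependent.comp _ Subtype.val_injective

theorem card_topIdx_fiber {V : Type*} (m : V → ℕ) (i : V) :
    Nat.card {r : TopIdx m // r.1 = i} = m i := by
  rw [Nat.card_congr (Equiv.sigmaSubtype i)]
  simp

/-- A module annihilated by the radical is determined, up to isomorphism, by the numbers of elements
of a basis which are normed by the various vertices. -/
theorem nonempty_equiv_semisimple_of_basis (hI : IsAdmissible I)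
    (hM : ∀ a ∈ Ring.jacobson (BoundAlg I), ∀ x : M, a • x = 0)
    {κ : Type*} [Finite κ] (b : Module.Basis κ K M) (ν : κ → V)
    (hb : ∀ k, vert I (ν k) • b k = b k) {m : V → ℕ} (hm : ∀ i, Nat.card {k // ν k = i} = m i) :
    Nonempty (M ≃ₗ[BoundAlg I] SemisimpleMod I m) := by
  let e : κ ≃ TopIdx m := (Equiv.sigmaFiberEquiv ν).symm.trans
    (Equiv.sigmaCongrRight fun i => Finite.equivFinOfCardEq (hm i))
  have he : ∀ k, (e k).1 = ν k := fun k => rfl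
  let g : M ≃ₗ[K] SemisimpleMod I m := b.equiv (semisimpleBasis hI m) e
  have hgb : ∀ k, g (b k) = semisimpleBasis hI m (e k) := fun k => b.equiv_apply _ _ _
  refine ⟨LinearEquiv.ofBijective (homOfVert hI hM (fun a ha x => jacobson_smul_semisimple ha x)
    g.toLinearMap fun i x => ?_) g.bijective⟩
  have h : g.toLinearMap ∘ₗ Algebra.lsmul K K M (vert I i) =
      Algebra.lsmul K K (SemisimpleMod I m) (vert I i) ∘ₗ g.toLinearMap := by
    refine b.ext fun k => ?_
    change g (vert I i • b k) = vert I i • g (b k)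
    rw [hgb]
    have h2 := semisimpleBasis_normed hI m (e k)
    rw [he] at h2
    by_cases hk : i = ν k
    · rw [hk, hb, h2, hgb]
    · have h3 : vert I i • semisimpleBasis hI m (e k) = 0 :=
        vert_smul_of_ne (I := I) (M := SemisimpleMod I m) h2 hk
      rw [vert_smul_of_ne (hb k) hk, h3, map_zero]
  exact LinearMap.congr_fun h x

theorem exists_normed_basis (hI : IsAdmissible I) {m : V → ℕ}
    (h : Nonempty (M ≃ₗ[BoundAlg I] SemisimpleMod I m)) :
    ∃ b : Module.Basis (TopIdx m) K M, ∀ r, vert I r.1 • b r = b r := by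
  obtain ⟨φ⟩ := h
  refine ⟨(semisimpleBasis hI m).map (φ.symm.restrictScalars K), fun r => ?_⟩
  rw [Module.Basis.map_apply]
  change vert I r.1 • φ.symm _ = φ.symm _
  rw [← map_smul, semisimpleBasis_normed]

/-- Semisimple quotients of modules annihilated by the Jacobson radical embed. -/
theorem exists_injective_of_surjective (hI : IsAdmissible I)
    (hM : ∀ a ∈ Ring.jacobson (BoundAlg I), ∀ x : M, a • x = 0) (g : M →ₗ[BoundAlg I] N)
    (hg : Function.Surjective g) {m : V → ℕ}
    (h : Nonempty (N ≃ₗ[BoundAlg I] SemisimpleMod I m)) :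
    ∃ f : SemisimpleMod I m →ₗ[BoundAlg I] M, Function.Injective f := by
  obtain ⟨b, hb⟩ := exists_normed_basis (K := K) hI h
  choose c hc using fun r => hg (b r)
  have hs := semisimpleBasis_normed hI m
  let f : SemisimpleMod I m →ₗ[K] M :=
    (semisimpleBasis hI m).constr K fun r => vert I r.1 • c r
  have hf : ∀ r, f (semisimpleBasis hI m r) = vert I r.1 • c r := fun r =>
    Module.Basis.constr_basis _ _ _ _
  refine ⟨homOfVert hI (fun a ha x => jacobson_smul_semisimple ha x) hM f fun i x => ?_, ?_⟩
  · have h : f ∘ₗ Algebra.lsmul K K (SemisimpleMod I m) (vert I i) =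
        Algebra.lsmul K K M (vert I i) ∘ₗ f := by
      refine (semisimpleBasis hI m).ext fun r => ?_
      change f (vert I i • semisimpleBasis hI m r) = vert I i • f (semisimpleBasis hI m r)
      have h2 : vert I r.1 • vert I r.1 • c r = vert I r.1 • c r := by
        rw [smul_smul, vert_mul_self]
      rw [hf]
      by_cases hk : i = r.1
      · rw [hk, hs, h2, hf]
      · have h3 : vert I i • semisimpleBasis hI m r = 0 :=
          vert_smul_of_ne (I := I) (M := SemisimpleMod I m) (hs r) hk
        rw [h3, vert_smul_of_ne h2 hk, map_zero]
    exact LinearMap.congr_fun h x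
  · have h : (g.restrictScalars K) ∘ₗ f =
        ((semisimpleBasis hI m).equiv b (Equiv.refl _)).toLinearMap := by
      refine (semisimpleBasis hI m).ext fun r => ?_
      change g (f _) = (semisimpleBasis hI m).equiv b (Equiv.refl _) _
      rw [hf, map_smul, hc, hb, Module.Basis.equiv_apply]
      rfl
    have h2 : Function.Injective ((g.restrictScalars K) ∘ₗ f) := by
      rw [h]
      exact LinearEquiv.injective _
    exact Function.Injective.of_comp (f := g) h2

end NormedFamilies

/-! ### Bases adapted to the radical filtration -/

section RadicalFiltration

variable {K A M κ : Type*} [Field K] [Ring A] [Algebra K A] [AddCommGroup M] [Module K M]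
  [Module A M] [IsScalarTower K A M]

/-- A linearly independent family `v` with a level function `ℓ` is adapted to the radical filtration
if `J ^ l M` is spanned by the `v k` of level at least `l`. The elements of level `l` then induce a
basis of the `l`-th radical layer. -/
theorem layer_basis_of_adapted {v : κ → M} {ℓ : κ → ℕ} (hv : LinearIndependent K v)
    {l : ℕ} (hl : (radPow A M l).restrictScalars K = Submodule.span K (v '' {k | l ≤ ℓ k}))
    (hl' : (radPow A M (l + 1)).restrictScalars K = Submodule.span K (v '' {k | l + 1 ≤ ℓ k})) :
    LinearIndependent K (fun k : {k // ℓ k = l} => (radPow A M (l + 1)).mkQ (v k)) ∧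
      Submodule.span K (Set.range fun k : {k // ℓ k = l} => (radPow A M (l + 1)).mkQ (v k)) =
        (radLayer A M l).restrictScalars K := by
  set q : M →ₗ[K] M ⧸ radPow A M (l + 1) := (radPow A M (l + 1)).mkQ.restrictScalars K with hq
  have hker : LinearMap.ker q = (radPow A M (l + 1)).restrictScalars K := by
    rw [hq, LinearMap.ker_restrictScalars, Submodule.ker_mkQ]
  constructor
  · refine (hv.comp _ Subtype.val_injective).map (f := q) ?_
    rw [hker, hl', Set.range_comp, Subtype.range_coe_subtype]
    refine hv.disjoint_span_image (Set.disjoint_left.2 fun k hk hk' => ?_)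
    replace hk : ℓ k = l := hk
    replace hk' : l + 1 ≤ ℓ k := hk'
    omega
  · have h1 : (radLayer A M l).restrictScalars K = ((radPow A M l).restrictScalars K).map q := rfl
    have h2 : (Set.range fun k : {k // ℓ k = l} => (radPow A M (l + 1)).mkQ (v k)) =
        q '' (v '' {k | ℓ k = l}) := by
      ext x; simp [hq]
    rw [h1, hl, h2, ← Submodule.map_span]
    refine le_antisymm (Submodule.map_mono (Submodule.span_mono (Set.image_mono fun k hk => ?_))) ?_
    · exact ge_of_eq (show ℓ k = l from hk)
    · rw [Submodule.map_span, Submodule.span_le]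
      rintro _ ⟨_, ⟨k, hk, rfl⟩, rfl⟩
      rcases Nat.eq_or_lt_of_le hk with h | h
      · exact ⟨v k, Submodule.subset_span ⟨k, h.symm, rfl⟩, rfl⟩
      · have h3 : v k ∈ LinearMap.ker q := by
          rw [hker, hl']
          exact Submodule.subset_span ⟨k, h, rfl⟩
        rw [SetLike.mem_coe, LinearMap.mem_ker.1 h3]
        exact Submodule.zero_mem _

/-- A family which spans all the radical layers spans `M`, by descending induction along the radical
filtration. -/
theorem span_eq_top_of_layer {v : κ → M} {ℓ : κ → ℕ} {L : ℕ} (hL : radPow A M (L + 1) = ⊥)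
    (hspan : ∀ l ≤ L,
      Submodule.span K (Set.range fun k : {k // ℓ k = l} => (radPow A M (l + 1)).mkQ (v k)) =
        (radLayer A M l).restrictScalars K) :
    Submodule.span K (Set.range v) = ⊤ := by
  have key : ∀ l ≤ L + 1, (radPow A M l).restrictScalars K ≤ Submodule.span K (Set.range v) := by
    intro l hl
    induction hl using Nat.decreasingInduction with
    | self =>
      intro x hx
      rw [hL] at hx
      rw [(Submodule.mem_bot A).1 hx]
      exact Submodule.zero_mem _
    | of_succ l hl ih =>
      intro x hx
      have h1 : (radPow A M (l + 1)).mkQ x ∈ (radLayer A M l).restrictScalars K := ⟨x, hx, rfl⟩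
      have h2 : (Set.range fun k : {k // ℓ k = l} => (radPow A M (l + 1)).mkQ (v k)) =
          (radPow A M (l + 1)).mkQ.restrictScalars K '' (v '' {k | ℓ k = l}) := by
        ext x; simp
      rw [← hspan l (by omega), h2, ← Submodule.map_span] at h1
      obtain ⟨y, hy, hyx⟩ := h1
      have h3 : x - y ∈ radPow A M (l + 1) := by
        rw [← Submodule.Quotient.mk_eq_zero, Submodule.Quotient.mk_sub, sub_eq_zero]
        exact hyx.symm
      rw [← sub_add_cancel x y]
      exact add_mem (ih h3) (Submodule.span_mono (Set.image_subset_range _ _) hy)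
  refine eq_top_iff.2 fun x _ => key 0 (Nat.zero_le _) ?_
  rw [radPow_zero]
  trivial

theorem finrank_radLayer_add [Module.Finite K M] (l : ℕ) :
    Module.finrank K (radLayer A M l) + Module.finrank K (radPow A M (l + 1)) =
      Module.finrank K (radPow A M l) := by
  have : Module.Finite K (radPow A M l) :=
    inferInstanceAs (Module.Finite K ((radPow A M l).restrictScalars K))
  let q : radPow A M l →ₗ[K] M ⧸ radPow A M (l + 1) :=
    (radPow A M (l + 1)).mkQ.restrictScalars K ∘ₗ (radPow A M l).subtype.restrictScalars K
  have hr : LinearMap.range q = (radLayer A M l).restrictScalars K := by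
    ext x
    constructor
    · rintro ⟨y, rfl⟩
      exact ⟨y, y.2, rfl⟩
    · rintro ⟨y, hy, rfl⟩
      exact ⟨⟨y, hy⟩, rfl⟩
  have hk : (LinearMap.ker q).map ((radPow A M l).subtype.restrictScalars K) =
      (radPow A M (l + 1)).restrictScalars K := by
    ext x
    constructor
    · rintro ⟨y, hy, rfl⟩
      exact (Submodule.Quotient.mk_eq_zero _).1 hy
    · intro hx
      exact ⟨⟨x, radPow_succ_le A M l hx⟩, (Submodule.Quotient.mk_eq_zero _).2 hx, rfl⟩
  have h := LinearMap.finrank_range_add_finrank_ker q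
  have hk2 : Module.finrank K (LinearMap.ker q) = Module.finrank K (radPow A M (l + 1)) := by
    have h2 := LinearEquiv.finrank_eq ((LinearMap.ker q).equivMapOfInjective
      ((radPow A M l).subtype.restrictScalars K) Subtype.val_injective)
    rw [h2, hk]
    rfl
  rw [hr, hk2] at h
  exact h

/-- Descending induction on `l`, starting from `J ^ (L + 1) M = 0`. -/
theorem finrank_radPow_eq_card [Module.Finite K M] [Finite κ] {ℓ : κ → ℕ} {L : ℕ}
    (hL : radPow A M (L + 1) = ⊥) (hℓ : ∀ k, ℓ k ≤ L)
    (hcard : ∀ l ≤ L, Module.finrank K (radLayer A M l) = Nat.card {k // ℓ k = l}) (l : ℕ)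
    (hl : l ≤ L + 1) : Module.finrank K (radPow A M l) = Nat.card {k // l ≤ ℓ k} := by
  induction hl using Nat.decreasingInduction with
  | self =>
    have : IsEmpty {k // L + 1 ≤ ℓ k} := ⟨fun k => by have := hℓ k.1; have := k.2; omega⟩
    rw [hL, Nat.card_of_isEmpty]
    exact finrank_bot K M
  | of_succ l hl ih =>
    rw [← finrank_radLayer_add, ih, hcard l (by omega)]
    classical
    have := Fintype.ofFinite κ
    simp only [Nat.card_eq_fintype_card]
    rw [Fintype.card_subtype, Fintype.card_subtype, Fintype.card_subtype,
      ← Finset.card_union_of_disjoint]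
    · congr 1
      ext k
      simp only [Finset.mem_union, Finset.mem_filter, Finset.mem_univ, true_and]
      omega
    · rw [Finset.disjoint_filter]
      intros
      omega

/-- A spanning family with `v k ∈ J ^ (ℓ k) M`, which has as many elements of each level as the
dimension of the corresponding radical layer, is adapted to the radical filtration: the total count
makes it a basis, and the elements of level at least `l` are independent elements of `J ^ l M`, as
many as its dimension. -/
theorem adapted_of_span_eq_top [Module.Finite K M] [Finite κ] {v : κ → M} {ℓ : κ → ℕ} {L : ℕ}
    (hL : radPow A M (L + 1) = ⊥) (hℓ : ∀ k, ℓ k ≤ L) (hmem : ∀ k, v k ∈ radPow A M (ℓ k))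
    (hcard : ∀ l ≤ L, Module.finrank K (radLayer A M l) = Nat.card {k // ℓ k = l})
    (hv : Submodule.span K (Set.range v) = ⊤) :
    LinearIndependent K v ∧
      ∀ l, (radPow A M l).restrictScalars K = Submodule.span K (v '' {k | l ≤ ℓ k}) := by
  have := Fintype.ofFinite κ
  classical
  have hLI : LinearIndependent K v := by
    refine linearIndependent_of_top_le_span_of_card_eq_finrank hv.ge ?_
    have h := finrank_radPow_eq_card (K := K) hL hℓ hcard 0 (Nat.zero_le _)
    rw [radPow_zero] at h
    have h2 : Module.finrank K (⊤ : Submodule A M) = Module.finrank K M := finrank_top K M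
    rw [h2] at h
    rw [h, ← Nat.card_eq_fintype_card]
    exact Nat.card_congr (Equiv.subtypeUnivEquiv fun k => Nat.zero_le _).symm
  refine ⟨hLI, fun l => ?_⟩
  have hle : Submodule.span K (v '' {k | l ≤ ℓ k}) ≤ (radPow A M l).restrictScalars K := by
    rw [Submodule.span_le]
    rintro _ ⟨k, hk, rfl⟩
    exact radPow_antitone A M hk (hmem k)
  by_cases hl : L + 1 ≤ l
  · refine le_antisymm (fun x hx => ?_) hle
    have h := radPow_antitone A M hl hx
    rw [hL, Submodule.mem_bot] at h
    rw [h]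
    exact Submodule.zero_mem _
  · refine (Submodule.eq_of_le_of_finrank_eq hle ?_).symm
    rw [← Subtype.range_coe_subtype, ← Set.range_comp, finrank_span_eq_card
      (hLI.comp _ Subtype.val_injective), ← Nat.card_eq_fintype_card]
    exact (finrank_radPow_eq_card (K := K) hL hℓ hcard l (by omega)).symm

end RadicalFiltration

/-! ### Distinguished skeleta and adapted bases -/

section Skeleta

variable {K : Type w} {V : Type u} [Field K] [Fintype V] [Quiver.{v} V]
variable {I : Ideal (PathAlgebra K V)} [I.IsTwoSided]
variable {M : Type*} [AddCommGroup M] [Module K M] [Module (BoundAlg I) M]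
  [IsScalarTower K (BoundAlg I) M]

local instance : Ring (BoundAlg I) := inferInstance
local instance : Semiring (BoundAlg I) := inferInstance
local instance : AddCommGroup (BoundAlg I) := inferInstance

theorem exists_basis_of_span_eq {K W κ : Type*} [Field K] [AddCommGroup W] [Module K W]
    (W₀ : Submodule K W) {w : κ → W} (hw : LinearIndependent K w)
    (hs : Submodule.span K (Set.range w) = W₀) :
    ∃ b : Module.Basis κ K W₀, ∀ k, (b k : W) = w k := by
  subst hs
  exact ⟨Module.Basis.span hw, fun k => congrArg Subtype.val (Module.Basis.span_apply hw k)⟩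

theorem exists_basis_radLayer {A : Type*} {M κ : Type*} [Ring A] [Algebra K A] [AddCommGroup M]
    [Module K M] [Module A M] [IsScalarTower K A M] {l : ℕ} {w : κ → M ⧸ radPow A M (l + 1)}
    (hw : LinearIndependent K w)
    (hs : Submodule.span K (Set.range w) = (radLayer A M l).restrictScalars K) :
    ∃ b : Module.Basis κ K (radLayer A M l), ∀ k, (b k : M ⧸ radPow A M (l + 1)) = w k :=
  exists_basis_of_span_eq _ hw hs

theorem radLayer_equiv_of_adapted (hI : IsAdmissible I) {κ : Type*} [Finite κ] {v : κ → M}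
    {ν : κ → V} {ℓ : κ → ℕ} (hν : ∀ k, vert I (ν k) • v k = v k) (hv : LinearIndependent K v)
    {l : ℕ} (hl : (radPow (BoundAlg I) M l).restrictScalars K =
      Submodule.span K (v '' {k | l ≤ ℓ k}))
    (hl' : (radPow (BoundAlg I) M (l + 1)).restrictScalars K =
      Submodule.span K (v '' {k | l + 1 ≤ ℓ k})) {t : V → ℕ}
    (ht : ∀ i, Nat.card {k : {k // ℓ k = l} // ν k = i} = t i) :
    Nonempty (radLayer (BoundAlg I) M l ≃ₗ[BoundAlg I] SemisimpleMod I t) := by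
  obtain ⟨h1, h2⟩ := layer_basis_of_adapted hv hl hl'
  obtain ⟨b, hb⟩ := exists_basis_radLayer h1 h2
  refine nonempty_equiv_semisimple_of_basis hI (fun a ha x => jacobson_smul_radLayer ha x) b
    (fun k => ν k) (fun k => Subtype.ext ?_) ht
  change vert I (ν k) • (b k : M ⧸ radPow (BoundAlg I) M (l + 1)) = _
  rw [hb, ← map_smul, hν]

theorem hasRadLayering_of_adapted (hI : IsAdmissible I) {κ : Type*} [Finite κ] {v : κ → M}
    {ν : κ → V} {ℓ : κ → ℕ} (hν : ∀ k, vert I (ν k) • v k = v k) (hv : LinearIndependent K v)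
    (hF : ∀ l, (radPow (BoundAlg I) M l).restrictScalars K =
      Submodule.span K (v '' {k | l ≤ ℓ k}))
    {L : ℕ} {S : Fin (L + 1) → V → ℕ}
    (hS : ∀ (l : Fin (L + 1)) i, Nat.card {k : {k // ℓ k = l} // ν k = i} = S l i) :
    HasRadLayering I M S :=
  fun l => radLayer_equiv_of_adapted hI hν hv (hF l) (hF (l + 1)) (hS l)

theorem HasRadLayering.finrank_radLayer (hI : IsAdmissible I) {L : ℕ} {S : Fin (L + 1) → V → ℕ}
    (h : HasRadLayering I M S) (l : Fin (L + 1)) :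
    Module.finrank K (radLayer (BoundAlg I) M l) = ∑ i, S l i := by
  obtain ⟨b, -⟩ := exists_normed_basis (K := K) hI (h l)
  rw [Module.finrank_eq_card_basis b]
  simp

theorem hasTop_of_radLayer_zero {M : Type*} [AddCommGroup M] [Module (BoundAlg I) M] {t : V → ℕ}
    (h : Nonempty (radLayer (BoundAlg I) M 0 ≃ₗ[BoundAlg I] SemisimpleMod I t)) :
    HasTop I M t := by
  obtain ⟨φ⟩ := h
  have h1 : radLayer (BoundAlg I) M 0 = ⊤ := by
    rw [radLayer, radPow_zero, Submodule.map_top, Submodule.range_mkQ]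
  have h2 : radPow (BoundAlg I) M (0 + 1) = Ring.jacobson (BoundAlg I) • ⊤ := radPow_one _ _
  exact ⟨(Submodule.quotEquivOfEq _ _ h2.symm).trans
    (Submodule.topEquiv.symm.trans ((LinearEquiv.ofEq _ _ h1.symm).trans φ))⟩

variable {m : V → ℕ} {L : ℕ} {S : Fin (L + 1) → V → ℕ} {σ : Set (HatPath m)}

omit [Fintype V] in
theorem IsSkeleton.nil_mem {t : V → ℕ} (hσ : IsSkeleton L t σ) {p : HatPath m} (hp : p ∈ σ) :
    HatPath.nil p.idx ∈ σ :=
  hσ.initial p.idx p.idx.1 p.target Quiver.Path.nil p.path (by rwa [Quiver.Path.nil_comp])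

/-- The paths of length `l` in `σ`, as a subtype of `σ`. -/
def layerEquiv (σ : Set (HatPath m)) (l : ℕ) :
    {p : σ // p.1.path.length = l} ≃ layer σ l where
  toFun p := ⟨p.1.1, p.1.2, p.2⟩
  invFun p := ⟨⟨p.1, p.2.1⟩, p.2.2⟩

omit [Fintype V] in
theorem Compatible.card_layer (hS : Compatible S σ) (l : Fin (L + 1)) (i : V) :
    Nat.card {k : {p : σ // p.1.path.length = l} // k.1.1.target = i} = S l i := by
  have h : Nat.card {p ∈ layer σ l | p.target = i} = S l i := by
    rw [Nat.card_coe_set_eq, Set.ncard, hS l i, ENat.toNat_natCast]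
  rw [← h]
  exact Nat.card_congr
    { toFun := fun k => ⟨k.1.1.1, ⟨k.1.1.2, k.1.2⟩, k.2⟩
      invFun := fun k => ⟨⟨⟨k.1, k.2.1.1⟩, k.2.1.2⟩, k.2.2⟩ }

omit [Fintype V] in
theorem Compatible.finite [Finite V] (hS : Compatible S σ) (hL : ∀ p ∈ σ, p.path.length ≤ L) :
    σ.Finite := by
  refine (Set.finite_iUnion fun l : Fin (L + 1) => Set.finite_iUnion fun i : V =>
    Set.finite_of_encard_eq_coe (hS l i)).subset fun p hp => ?_
  exact Set.mem_iUnion.2 ⟨⟨p.path.length, Nat.lt_succ_of_le (hL p hp)⟩,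
    Set.mem_iUnion.2 ⟨p.target, ⟨hp, rfl⟩, rfl⟩⟩

variable (I) in
/-- The canonical map from `Q̂` to `Q`. -/
def hatProj (m : V → ℕ) : ProjHat K m →ₛₗ[Ideal.Quotient.mk I] ProjMod I m where
  toFun q r := ⟨Ideal.Quotient.mk I (q r), by
    obtain ⟨a, ha⟩ := Ideal.mem_span_singleton'.1 (q r).2
    rw [← ha, map_mul]
    exact Ideal.mul_mem_left _ _ (Ideal.subset_span rfl)⟩
  map_add' q q' := by
    ext r
    exact map_add (Ideal.Quotient.mk I) _ _
  map_smul' a q := by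
    ext r
    exact map_mul (Ideal.Quotient.mk I) _ _

theorem hatProj_hatElt (m : V → ℕ) (r : TopIdx m) :
    hatProj I m (hatElt K m r) = topElt I m r := by
  classical
  funext s
  refine Subtype.ext ?_
  by_cases h : s = r
  · subst h
    simp only [hatProj, hatElt, topElt, LinearMap.coe_mk, AddHom.coe_mk, Pi.single_eq_same]
    rfl
  · simp only [hatProj, hatElt, topElt, LinearMap.coe_mk, AddHom.coe_mk]
    rw [Pi.single_eq_of_ne h, Pi.single_eq_of_ne h]
    exact map_zero (Ideal.Quotient.mk I)

theorem hatProj_surjective (m : V → ℕ) : Function.Surjective (hatProj I m) := by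
  intro q
  have h : ∀ r, ∃ a : PathAlgebra K V, Ideal.Quotient.mk I a * vert I r.1 = q r := by
    intro r
    obtain ⟨a, ha⟩ := Ideal.mem_span_singleton'.1 (q r).2
    obtain ⟨a, rfl⟩ := Ideal.Quotient.mk_surjective a
    exact ⟨a, ha⟩
  choose a ha using h
  refine ⟨fun r => ⟨a r * idem K r.1, Ideal.mul_mem_left _ _ (Ideal.subset_span rfl)⟩, ?_⟩
  funext r
  refine Subtype.ext ?_
  rw [← ha r]
  exact map_mul (Ideal.Quotient.mk I) _ _

theorem topElt_self (m : V → ℕ) (r : TopIdx m) :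
    topElt I m r r = ⟨vert I r.1, Ideal.subset_span rfl⟩ := by
  classical
  rw [topElt, Pi.single_eq_same]

theorem vert_smul_topElt (m : V → ℕ) (r : TopIdx m) :
    vert I r.1 • topElt I m r = topElt I m r := by
  classical
  rw [topElt, ← Pi.single_smul]
  congr 1
  exact Subtype.ext (vert_mul_self I r.1)

theorem toProj_eq (p : HatPath m) : p.toProj I = pathClass I p.path • topElt I m p.idx := rfl

theorem toProj_nil (r : TopIdx m) : (HatPath.nil r).toProj I = topElt I m r :=
  vert_smul_topElt m r

theorem span_topElt (m : V → ℕ) :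
    Submodule.span (BoundAlg I) (Set.range (topElt I m)) = ⊤ := by
  classical
  refine eq_top_iff.2 fun q _ => ?_
  rw [← Finset.univ_sum_single q]
  refine Submodule.sum_mem _ fun r _ => ?_
  obtain ⟨a, ha⟩ := Ideal.mem_span_singleton'.1 (q r).2
  have h : Pi.single r (q r) = a • topElt I m r := by
    rw [topElt, ← Pi.single_smul]
    congr 1
    exact Subtype.ext ha.symm
  rw [h]
  exact Submodule.smul_mem _ _ (Submodule.subset_span ⟨r, rfl⟩)

/-- The residue classes in `Q / C` of the elements `p z_r` with `p ẑ_r ∈ σ`. -/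
def skelFam (σ : Set (HatPath m)) (C : Submodule (BoundAlg I) (ProjMod I m)) :
    σ → ProjMod I m ⧸ C := fun p => C.mkQ (p.1.toProj I)

variable {C : Submodule (BoundAlg I) (ProjMod I m)}

theorem skelFam_normed (p : σ) : vert I p.1.target • skelFam σ C p = skelFam σ C p := by
  rw [skelFam, toProj_eq, map_smul, vert_smul_pathClass_smul]

theorem skelFam_mem (hI : IsAdmissible I) (p : σ) :
    skelFam σ C p ∈ radPow (BoundAlg I) (ProjMod I m ⧸ C) p.1.path.length := by
  rw [skelFam, toProj_eq, map_smul]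
  exact pathClass_smul_mem_radPow hI _ _

/-- The map `f` in the definition of a distinguished skeleton sends `p ẑ_r` to `p z_r + C`, so that
the condition on the radical layers concerns the elements `p z_r + C` themselves. -/
theorem IsDistinguished.layers {t : V → ℕ} (hσ : IsSkeleton L t σ) (h : IsDistinguished I L σ C)
    {l : ℕ} (hl : l ≤ L) :
    LinearIndependent K (fun k : {p : σ // p.1.path.length = l} =>
        (radPow (BoundAlg I) (ProjMod I m ⧸ C) (l + 1)).mkQ (skelFam σ C k)) ∧
      Submodule.span K (Set.range fun k : {p : σ // p.1.path.length = l} =>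
        (radPow (BoundAlg I) (ProjMod I m ⧸ C) (l + 1)).mkQ (skelFam σ C k)) =
          (radLayer (BoundAlg I) (ProjMod I m ⧸ C) l).restrictScalars K := by
  obtain ⟨-, f, -, hf, hlay⟩ := h
  obtain ⟨h1, h2⟩ := hlay l hl
  have hfe : (fun k : {p : σ // p.1.path.length = l} =>
      (radPow (BoundAlg I) (ProjMod I m ⧸ C) (l + 1)).mkQ (skelFam σ C k)) =
      (fun p : layer σ l => (radPow (BoundAlg I) (ProjMod I m ⧸ C) (l + 1)).mkQ
        (f (p.1.elt K))) ∘ layerEquiv σ l := by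
    funext k
    have h3 := hf ⟨k.1.1.idx, hσ.nil_mem k.1.2⟩
    change _ = (radPow (BoundAlg I) (ProjMod I m ⧸ C) (l + 1)).mkQ (f (k.1.1.elt K))
    rw [HatPath.elt, map_smulₛₗ, h3, skelFam, toProj_eq, map_smul C.mkQ]
    rfl
  rw [hfe]
  refine ⟨(linearIndependent_equiv (layerEquiv σ l)).2 h1, ?_⟩
  rw [(layerEquiv σ l).surjective.range_comp, h2]

theorem isDistinguished_of_adapted {t : V → ℕ} (hσ : IsSkeleton L t σ)
    (hv : LinearIndependent K (skelFam σ C))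
    (hF : ∀ l, (radPow (BoundAlg I) (ProjMod I m ⧸ C) l).restrictScalars K =
      Submodule.span K (skelFam σ C '' {p | l ≤ p.1.path.length})) :
    IsDistinguished I L σ C := by
  have hlay := fun l => layer_basis_of_adapted hv (hF l) (hF (l + 1))
  have hx : LinearIndependent K fun r : {r : TopIdx m // HatPath.nil r ∈ σ} =>
      (Ring.jacobson (BoundAlg I) • ⊤ : Submodule (BoundAlg I) (ProjMod I m ⧸ C)).mkQ
        (C.mkQ (topElt I m r.1)) := by
    rw [← radPow_one]
    have h0 := (hlay 0).1.comp (fun r : {r : TopIdx m // HatPath.nil r ∈ σ} =>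
      (⟨⟨HatPath.nil r.1, r.2⟩, rfl⟩ : {p : σ // p.1.path.length = 0})) fun r s hrs => by
        refine Subtype.ext ?_
        exact congrArg (fun k => k.1.1.idx) hrs
    convert h0 using 2 with r
    simp only [Function.comp, skelFam, toProj_nil]
  refine ⟨⟨fun r => ⟨r.1.1, ?_⟩, fun r hr => ?_, ?_, hx⟩, C.mkQ.comp (hatProj I m), ?_, ?_, ?_⟩
  · rw [← map_smul, vert_smul_topElt]
  · refine hx.ne_zero r ?_
    rw [Submodule.mkQ_apply, Submodule.Quotient.mk_eq_zero]
    exact hr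
  · have h0 := hF 0
    rw [radPow_zero] at h0
    refine eq_top_iff.2 fun x _ => ?_
    have h1 : x ∈ Submodule.span K (skelFam σ C '' {p | 0 ≤ p.1.path.length}) := by
      rw [← h0]
      trivial
    refine (Submodule.span_le (p := (Submodule.span (BoundAlg I)
      (Set.range fun r : {r : TopIdx m // HatPath.nil r ∈ σ} =>
        C.mkQ (topElt I m r.1))).restrictScalars K)).2 ?_ h1
    rintro _ ⟨p, -, rfl⟩
    rw [skelFam, toProj_eq, map_smul]
    exact Submodule.smul_mem _ _ (Submodule.subset_span
      (Set.mem_range_self (f := fun r : {r : TopIdx m // HatPath.nil r ∈ σ} =>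
        C.mkQ (topElt I m r.1)) ⟨p.1.idx, hσ.nil_mem p.2⟩))
  · exact C.mkQ_surjective.comp (hatProj_surjective m)
  · intro r
    exact congrArg C.mkQ (hatProj_hatElt m r.1)
  · intro l _
    obtain ⟨h1, h2⟩ := hlay l
    have hfe : (fun k : {p : σ // p.1.path.length = l} =>
        (radPow (BoundAlg I) (ProjMod I m ⧸ C) (l + 1)).mkQ (skelFam σ C k)) =
        (fun p : layer σ l => (radPow (BoundAlg I) (ProjMod I m ⧸ C) (l + 1)).mkQ
          (C.mkQ.comp (hatProj I m) (p.1.elt K))) ∘ layerEquiv σ l := by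
      funext k
      change _ = (radPow (BoundAlg I) (ProjMod I m ⧸ C) (l + 1)).mkQ
        (C.mkQ.comp (hatProj I m) (k.1.1.elt K))
      rw [HatPath.elt, map_smulₛₗ, LinearMap.comp_apply, hatProj_hatElt, skelFam, toProj_eq,
        map_smul C.mkQ]
      rfl
    rw [hfe] at h1 h2
    rw [(layerEquiv σ l).surjective.range_comp] at h2
    exact ⟨(linearIndependent_equiv (layerEquiv σ l)).1 h1, h2⟩

end Skeleta

/-! ### Existence of distinguished skeleta -/

section Equivalence

variable {K : Type w} {V : Type u} [Field K] [Fintype V] [Quiver.{v} V]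
variable {I : Ideal (PathAlgebra K V)} [I.IsTwoSided]

local instance : Ring (BoundAlg I) := inferInstance
local instance : Semiring (BoundAlg I) := inferInstance
local instance : AddCommGroup (BoundAlg I) := inferInstance

variable {m : V → ℕ} {L : ℕ} {S : Fin (L + 1) → V → ℕ} {σ : Set (HatPath m)}
variable {C : Submodule (BoundAlg I) (ProjMod I m)}

theorem card_eq_sum_fiber {α β : Type*} [Finite α] [Fintype β] (f : α → β) :
    Nat.card α = ∑ b, Nat.card {a // f a = b} := by
  rw [← Nat.card_congr (Equiv.sigmaFiberEquiv f), Nat.card_sigma]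

theorem card_layer_eq_sum (hσ : ∀ p ∈ σ, p.path.length ≤ L) (hS : Compatible S σ)
    (l : Fin (L + 1)) : Nat.card {p : σ // p.1.path.length = l} = ∑ i, S l i := by
  have := (hS.finite hσ).to_subtype
  rw [card_eq_sum_fiber fun k : {p : σ // p.1.path.length = l} => k.1.1.target]
  exact Finset.sum_congr rfl fun i _ => hS.card_layer l i

theorem card_target_eq_sum (hσ : ∀ p ∈ σ, p.path.length ≤ L) (hS : Compatible S σ) (i : V) :
    Nat.card {p : σ // p.1.target = i} = ∑ l, S l i := by
  have := (hS.finite hσ).to_subtype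
  rw [card_eq_sum_fiber fun k : {p : σ // p.1.target = i} =>
    (⟨k.1.1.path.length, Nat.lt_succ_of_le (hσ _ k.1.2)⟩ : Fin (L + 1))]
  refine Finset.sum_congr rfl fun l _ => ?_
  rw [← hS.card_layer l i]
  exact Nat.card_congr
    { toFun := fun k => ⟨⟨k.1.1, congrArg Fin.val k.2⟩, k.1.2⟩
      invFun := fun k => ⟨⟨k.1.1, k.2⟩, Fin.ext k.1.2⟩ }

/-- If the dimensions of the radical layers of `Q / C` are the cardinalities of the layers of `σ`,
then a spanning family `(p z_r + C)` is adapted to the radical filtration. -/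
theorem skelFam_adapted [Module.Finite K (ProjMod I m)] (hI : IsAdmissible I)
    (hL : nilpotencyClass (Ring.jacobson (BoundAlg I)) = L + 1)
    (hσ : ∀ p ∈ σ, p.path.length ≤ L) (hS : Compatible S σ)
    (hlay : HasRadLayering I (ProjMod I m ⧸ C) S)
    (hspan : Submodule.span K (Set.range (skelFam σ C)) = ⊤) :
    LinearIndependent K (skelFam σ C) ∧
      ∀ l, (radPow (BoundAlg I) (ProjMod I m ⧸ C) l).restrictScalars K =
        Submodule.span K (skelFam σ C '' {p | l ≤ p.1.path.length}) := by
  have := (hS.finite hσ).to_subtype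
  refine adapted_of_span_eq_top (radPow_eq_bot_of_nilpotencyClass hL) (fun p => hσ p.1 p.2)
    (skelFam_mem hI) (fun l hl => ?_) hspan
  have h1 := hlay.finrank_radLayer (K := K) hI ⟨l, Nat.lt_succ_of_le hl⟩
  have h2 := card_layer_eq_sum hσ hS ⟨l, Nat.lt_succ_of_le hl⟩
  exact h1.trans h2.symm

/-- For a skeleton which is compatible with `S`, being distinguished means that `Q / C` has radical
layering `S` and is spanned by the elements `p z_r + C`. The second condition is an open one. -/
theorem isDistinguished_iff [Module.Finite K (ProjMod I m)] (hI : IsAdmissible I)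
    (hL : nilpotencyClass (Ring.jacobson (BoundAlg I)) = L + 1) {t : V → ℕ}
    (hσ : IsSkeleton L t σ) (hS : Compatible S σ) :
    IsDistinguished I L σ C ↔ HasRadLayering I (ProjMod I m ⧸ C) S ∧
      Submodule.span K (Set.range (skelFam σ C)) = ⊤ := by
  have := (hS.finite hσ.length_le).to_subtype
  have hbot : radPow (BoundAlg I) (ProjMod I m ⧸ C) (L + 1) = ⊥ :=
    radPow_eq_bot_of_nilpotencyClass hL
  constructor
  · intro h
    have hlay := fun l (hl : l ≤ L) => h.layers hσ hl
    have hspan := span_eq_top_of_layer hbot fun l hl => (hlay l hl).2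
    obtain ⟨hv, hF⟩ := adapted_of_span_eq_top hbot (fun p : σ => hσ.length_le p.1 p.2)
      (skelFam_mem hI) (fun l hl => by
        obtain ⟨b, -⟩ := exists_basis_radLayer (hlay l hl).1 (hlay l hl).2
        exact Module.finrank_eq_nat_card_basis b) hspan
    exact ⟨hasRadLayering_of_adapted hI skelFam_normed hv hF hS.card_layer, hspan⟩
  · rintro ⟨hlay, hspan⟩
    obtain ⟨hv, hF⟩ := skelFam_adapted hI hL hσ.length_le hS hlay hspan
    exact isDistinguished_of_adapted hσ hv hF

theorem hasDimVec_of_basis {M : Type*} [AddCommGroup M] [Module K M] [Module (BoundAlg I) M]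
    [IsScalarTower K (BoundAlg I) M] {κ : Type*} [Finite κ] {v : κ → M} {ν : κ → V}
    (hν : ∀ k, vert I (ν k) • v k = v k) (hv : LinearIndependent K v)
    (hspan : Submodule.span K (Set.range v) = ⊤) {d : V → ℕ}
    (hd : ∀ i, Nat.card {k // ν k = i} = d i) : HasDimVec I M d := by
  intro i
  rw [finrank_range_vert (Module.Basis.mk hv hspan.ge) ν (fun k => by simp [hν]) i, hd]

/-- Every subfamily contains a linearly independent subfamily with the same span. -/
theorem exists_subset_linearIndependent {ι W : Type*} [AddCommGroup W] [Module K W] (w : ι → W)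
    (T : Set ι) : ∃ s ⊆ T, LinearIndependent K (fun p : s => w p) ∧
      Submodule.span K (w '' s) = Submodule.span K (w '' T) := by
  obtain ⟨κ, a, ha, hspan, hli⟩ := exists_linearIndependent' K fun p : T => w p
  refine ⟨Set.range fun k => (a k : ι), ?_, ?_, ?_⟩
  · rintro _ ⟨k, rfl⟩
    exact (a k).2
  · have hinj : Function.Injective fun k => (a k : ι) := Subtype.val_injective.comp ha
    exact (linearIndependent_equiv (Equiv.ofInjective _ hinj)).1 hli
  · rw [← Set.range_comp]
    have h : w '' T = Set.range fun p : T => w p := by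
      ext x; simp
    rw [h, ← hspan]
    rfl

/-- The paths `α p ẑ_r`, where `α` is an arrow and `p ẑ_r` belongs to `s`. -/
def arrowExtension (s : Set (HatPath m)) : Set (HatPath m) :=
  {q | ∃ p ∈ s, ∃ (k : V) (e : p.target ⟶ k), q = ⟨p.idx, k, p.path.cons e⟩}

omit [Fintype V] in
theorem mem_of_cons_mem_arrowExtension {s : Set (HatPath m)} {r : TopIdx m} {j k : V}
    {p : Quiver.Path r.1 j} {e : j ⟶ k}
    (h : (⟨r, k, p.cons e⟩ : HatPath m) ∈ arrowExtension s) : (⟨r, j, p⟩ : HatPath m) ∈ s := by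
  obtain ⟨⟨r', j', p'⟩, hp, k', e', h⟩ := h
  cases h
  exact hp

/-- A version of Nakayama's lemma: normed generators span modulo the radical, already over `K`. -/
theorem span_sup_radPow_one {M κ : Type*} [AddCommGroup M] [Module K M] [Module (BoundAlg I) M]
    [IsScalarTower K (BoundAlg I) M] (hI : IsAdmissible I) {x : κ → M} {ν : κ → V}
    (hν : ∀ k, vert I (ν k) • x k = x k)
    (hx : Submodule.span (BoundAlg I) (Set.range x) = ⊤) :
    Submodule.span K (Set.range x) ⊔ (radPow (BoundAlg I) M 1).restrictScalars K = ⊤ := by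
  refine eq_top_iff.2 fun y _ => ?_
  have hy : y ∈ Submodule.span (BoundAlg I) (Set.range x) := hx ▸ Submodule.mem_top
  obtain ⟨c, rfl⟩ := Finsupp.mem_span_range_iff_exists_finsupp.1 hy
  refine Submodule.sum_mem _ fun k _ => ?_
  obtain ⟨s, hs, r, hr, hsr⟩ :=
    Submodule.mem_sup.1 (top_le_span_vert_sup I (Submodule.mem_top (x := c k)))
  rw [← mem_jacobson_iff_mem_pathSpan hI] at hr
  rw [← hsr]
  change (s + r) • x k ∈ _
  rw [add_smul]
  refine Submodule.add_mem_sup ?_ ?_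
  · have hle : Submodule.span K (Set.range (vert I)) ≤ (Submodule.span K (Set.range x)).comap
        ((Algebra.lsmul K K M).toLinearMap.flip (x k)) := by
      refine Submodule.span_le.2 ?_
      rintro _ ⟨i, rfl⟩
      change vert I i • x k ∈ Submodule.span K (Set.range x)
      by_cases hk : i = ν k
      · rw [hk, hν]
        exact Submodule.subset_span ⟨k, rfl⟩
      · rw [vert_smul_of_ne (hν k) hk]
        exact Submodule.zero_mem _
    exact hle hs
  · rw [Submodule.restrictScalars_mem, radPow_one]
    exact Submodule.smul_mem_smul hr trivial

theorem span_mkQ_topElt (C : Submodule (BoundAlg I) (ProjMod I m)) :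
    Submodule.span (BoundAlg I) (Set.range fun r => C.mkQ (topElt I m r)) = ⊤ := by
  have h : (Set.range fun r => C.mkQ (topElt I m r)) = C.mkQ '' Set.range (topElt I m) := by
    ext x; simp
  rw [h, ← Submodule.map_span, span_topElt, Submodule.map_top, Submodule.range_mkQ]

theorem span_radLayer_zero (C : Submodule (BoundAlg I) (ProjMod I m)) (hI : IsAdmissible I) :
    Submodule.span K ((fun p : HatPath m =>
      (radPow (BoundAlg I) (ProjMod I m ⧸ C) 1).mkQ (C.mkQ (p.toProj I))) ''
        Set.range HatPath.nil) =
      (radLayer (BoundAlg I) (ProjMod I m ⧸ C) 0).restrictScalars K := by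
  have hx := span_sup_radPow_one (K := K) hI (x := fun r => C.mkQ (topElt I m r))
    (ν := Sigma.fst) (fun r => by rw [← map_smul, vert_smul_topElt]) (span_mkQ_topElt C)
  refine le_antisymm (Submodule.span_le.2 ?_) ?_
  · rintro _ ⟨p, -, rfl⟩
    exact ⟨_, by rw [radPow_zero]; trivial, rfl⟩
  · rintro _ ⟨y, -, rfl⟩
    obtain ⟨w, hw, f, hf, rfl⟩ := Submodule.mem_sup.1 (hx.ge (Submodule.mem_top (x := y)))
    have h0 : (radPow (BoundAlg I) (ProjMod I m ⧸ C) (0 + 1)).mkQ f = 0 := by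
      rw [Submodule.mkQ_apply, Submodule.Quotient.mk_eq_zero]
      exact hf
    rw [map_add, h0, add_zero]
    have hle : Submodule.span K (Set.range fun r => C.mkQ (topElt I m r)) ≤
        (Submodule.span K ((fun p : HatPath m =>
          (radPow (BoundAlg I) (ProjMod I m ⧸ C) 1).mkQ (C.mkQ (p.toProj I))) ''
            Set.range HatPath.nil)).comap
          ((radPow (BoundAlg I) (ProjMod I m ⧸ C) 1).mkQ.restrictScalars K) := by
      refine Submodule.span_le.2 ?_
      rintro _ ⟨r, rfl⟩
      refine Submodule.subset_span ⟨HatPath.nil r, ⟨r, rfl⟩, ?_⟩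
      change (radPow (BoundAlg I) (ProjMod I m ⧸ C) 1).mkQ (C.mkQ ((HatPath.nil r).toProj I)) =
        (radPow (BoundAlg I) (ProjMod I m ⧸ C) 1).mkQ (C.mkQ (topElt I m r))
      rw [toProj_nil]
    exact hle hw

/-- If the `p z_r + C` with `p ẑ_r ∈ s` span a radical layer, then their multiples by arrows span the
next one, since `J` is generated by the arrows. -/
theorem span_radLayer_succ (C : Submodule (BoundAlg I) (ProjMod I m)) (hI : IsAdmissible I)
    {l : ℕ} {s : Set (HatPath m)} (hlen : ∀ p ∈ s, p.path.length = l)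
    (hs : Submodule.span K ((fun p : HatPath m =>
      (radPow (BoundAlg I) (ProjMod I m ⧸ C) (l + 1)).mkQ (C.mkQ (p.toProj I))) '' s) =
      (radLayer (BoundAlg I) (ProjMod I m ⧸ C) l).restrictScalars K) :
    Submodule.span K ((fun p : HatPath m =>
      (radPow (BoundAlg I) (ProjMod I m ⧸ C) (l + 2)).mkQ (C.mkQ (p.toProj I))) ''
        arrowExtension s) =
      (radLayer (BoundAlg I) (ProjMod I m ⧸ C) (l + 1)).restrictScalars K := by
  refine le_antisymm (Submodule.span_le.2 ?_) ?_
  · rintro _ ⟨_, ⟨p, hp, k, e, rfl⟩, rfl⟩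
    refine ⟨_, ?_, rfl⟩
    rw [toProj_eq, map_smul, ← hlen p hp]
    exact pathClass_smul_mem_radPow hI (p.path.cons e) _
  · set W := Submodule.span K ((fun p : HatPath m =>
      (radPow (BoundAlg I) (ProjMod I m ⧸ C) (l + 2)).mkQ (C.mkQ (p.toProj I))) ''
        arrowExtension s) with hW
    have hle : (radPow (BoundAlg I) (ProjMod I m ⧸ C) (l + 1)).restrictScalars K ≤
        W.comap ((radPow (BoundAlg I) (ProjMod I m ⧸ C) (l + 2)).mkQ.restrictScalars K) := by
      rw [radPow_succ, jacobson_smul_eq_span hI, Submodule.span_le]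
      rintro _ ⟨i, j, e, n, hn, rfl⟩
      change (radPow (BoundAlg I) (ProjMod I m ⧸ C) (l + 2)).mkQ (pathClass I e.toPath • n) ∈ W
      have h1 : (radPow (BoundAlg I) (ProjMod I m ⧸ C) (l + 1)).mkQ n ∈
          (radLayer (BoundAlg I) (ProjMod I m ⧸ C) l).restrictScalars K := ⟨n, hn, rfl⟩
      have h2 : ((fun p : HatPath m =>
          (radPow (BoundAlg I) (ProjMod I m ⧸ C) (l + 1)).mkQ (C.mkQ (p.toProj I))) '' s) =
          (radPow (BoundAlg I) (ProjMod I m ⧸ C) (l + 1)).mkQ.restrictScalars K ''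
            ((fun p : HatPath m => C.mkQ (p.toProj I)) '' s) := by
        rw [Set.image_image]
        rfl
      rw [← hs, h2, ← Submodule.map_span] at h1
      obtain ⟨y, hy, hyn⟩ := h1
      have h3 : n - y ∈ radPow (BoundAlg I) (ProjMod I m ⧸ C) (l + 1) := by
        rw [← Submodule.Quotient.mk_eq_zero, Submodule.Quotient.mk_sub, sub_eq_zero]
        exact hyn.symm
      have h4 : (radPow (BoundAlg I) (ProjMod I m ⧸ C) (l + 2)).mkQ
          (pathClass I e.toPath • (n - y)) = 0 := by
        rw [Submodule.mkQ_apply, Submodule.Quotient.mk_eq_zero, radPow_succ]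
        exact Submodule.smul_mem_smul (pathClass_mem_jacobson hI _ (by simp)) h3
      rw [smul_sub, map_sub, sub_eq_zero] at h4
      rw [h4]
      have hle2 : Submodule.span K ((fun p : HatPath m => C.mkQ (p.toProj I)) '' s) ≤
          W.comap ((radPow (BoundAlg I) (ProjMod I m ⧸ C) (l + 2)).mkQ.restrictScalars K ∘ₗ
            Algebra.lsmul K K (ProjMod I m ⧸ C) (pathClass I e.toPath)) := by
        rw [Submodule.span_le]
        rintro _ ⟨⟨r, i', p⟩, hp, rfl⟩
        change (radPow (BoundAlg I) (ProjMod I m ⧸ C) (l + 2)).mkQ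
          (pathClass I e.toPath • C.mkQ (pathClass I p • topElt I m r)) ∈ W
        rw [← map_smul, smul_smul]
        by_cases hi : i' = i
        · subst hi
          rw [pathClass_mul_comp]
          exact Submodule.subset_span ⟨⟨r, j, p.cons e⟩, ⟨_, hp, j, e, rfl⟩, rfl⟩
        · rw [pathClass_mul_of_ne I _ _ hi, zero_smul, map_zero, map_zero]
          exact W.zero_mem
      exact hle2 hy
    rintro _ ⟨x, hx, rfl⟩
    exact hle hx

/-- Every point with radical layering `S` has a distinguished skeleton: bases of the radical layers
are chosen successively among the `α p z_r + C`, where `α` is an arrow and `p z_r` belongs to the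
basis chosen for the previous layer. -/
theorem exists_isDistinguished [Module.Finite K (ProjMod I m)] (hI : IsAdmissible I)
    (hL : nilpotencyClass (Ring.jacobson (BoundAlg I)) = L + 1)
    (hlay : HasRadLayering I (ProjMod I m ⧸ C) S) :
    ∃ σ : Set (HatPath m), IsSkeleton L (S 0) σ ∧ Compatible S σ ∧ IsDistinguished I L σ C := by
  choose pick hsub hli hspan using fun (l : ℕ) => exists_subset_linearIndependent (K := K)
    fun p : HatPath m => (radPow (BoundAlg I) (ProjMod I m ⧸ C) (l + 1)).mkQ (C.mkQ (p.toProj I))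
  -- the successive layers of the skeleton
  let τ : ℕ → Set (HatPath m) := fun n =>
    Nat.rec (pick 0 (Set.range HatPath.nil)) (fun l s => pick (l + 1) (arrowExtension s)) n
  have hτ0 : τ 0 ⊆ Set.range HatPath.nil := hsub 0 _
  have hτs : ∀ l, τ (l + 1) ⊆ arrowExtension (τ l) := fun l => hsub (l + 1) _
  have hτli : ∀ l, LinearIndependent K fun p : τ l =>
      (radPow (BoundAlg I) (ProjMod I m ⧸ C) (l + 1)).mkQ (C.mkQ (p.1.toProj I)) := by
    intro l
    cases l with
    | zero => exact hli 0 _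
    | succ l => exact hli (l + 1) _
  have hτlen : ∀ l, ∀ p ∈ τ l, p.path.length = l := by
    intro l
    induction l with
    | zero =>
      intro p hp
      obtain ⟨r, rfl⟩ := hτ0 hp
      rfl
    | succ l ih =>
      intro p hp
      obtain ⟨q, hq, k, e, rfl⟩ := hτs l hp
      rw [Quiver.Path.length_cons, ih q hq]
  have hτspan : ∀ l, Submodule.span K ((fun p : HatPath m =>
      (radPow (BoundAlg I) (ProjMod I m ⧸ C) (l + 1)).mkQ (C.mkQ (p.toProj I))) '' τ l) =
      (radLayer (BoundAlg I) (ProjMod I m ⧸ C) l).restrictScalars K := by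
    intro l
    induction l with
    | zero => exact (hspan 0 _).trans (span_radLayer_zero C hI)
    | succ l ih => exact (hspan (l + 1) _).trans (span_radLayer_succ C hI (hτlen l) ih)
  let σ : Set (HatPath m) := {p | p.path.length ≤ L ∧ p ∈ τ p.path.length}
  have hlen : ∀ p ∈ σ, p.path.length ≤ L := fun p hp => hp.1
  let e (l : Fin (L + 1)) : {p : σ // p.1.path.length = l} ≃ {p // p ∈ τ l} :=
    { toFun := fun k => ⟨k.1.1, by
        have h : k.1.1 ∈ τ k.1.1.path.length := k.1.2.2
        rwa [k.2] at h⟩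
      invFun := fun p => ⟨⟨p.1, by
        change p.1.path.length ≤ L ∧ p.1 ∈ τ p.1.path.length
        rw [hτlen l p.1 p.2]
        exact ⟨Nat.le_of_lt_succ l.2, p.2⟩⟩, hτlen l p.1 p.2⟩ }
  have hL1 : ∀ l : Fin (L + 1), LinearIndependent K (fun k : {p : σ // p.1.path.length = l} =>
      (radPow (BoundAlg I) (ProjMod I m ⧸ C) (l + 1)).mkQ (skelFam σ C k)) := fun l =>
    (linearIndependent_equiv (e l)).2 (hτli l)
  have hL2 : ∀ l : Fin (L + 1), Submodule.span K (Set.range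
      fun k : {p : σ // p.1.path.length = l} =>
        (radPow (BoundAlg I) (ProjMod I m ⧸ C) (l + 1)).mkQ (skelFam σ C k)) =
          (radLayer (BoundAlg I) (ProjMod I m ⧸ C) l).restrictScalars K := by
    intro l
    rw [← hτspan l]
    congr 1
    ext x
    constructor
    · rintro ⟨k, rfl⟩
      exact ⟨_, (e l k).2, rfl⟩
    · rintro ⟨p, hp, rfl⟩
      exact ⟨(e l).symm ⟨p, hp⟩, rfl⟩
  have hcomp : Compatible S σ := by
    intro l i
    -- two normed bases of a layer have equally many elements normed by `i`
    obtain ⟨b, hb⟩ := exists_basis_radLayer (hL1 l) (hL2 l)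
    obtain ⟨b', hb'⟩ := exists_normed_basis (K := K) hI (hlay l)
    have : Module.Finite K (radLayer (BoundAlg I) (ProjMod I m ⧸ C) l) :=
      inferInstanceAs (Module.Finite K
        ((radLayer (BoundAlg I) (ProjMod I m ⧸ C) l).restrictScalars K))
    have : Finite {p : σ // p.1.path.length = l} := Module.Finite.finite_basis b
    have hbν : ∀ k, vert I k.1.1.target • b k = b k := by
      intro k
      refine Subtype.ext ?_
      rw [Submodule.coe_smul, hb, ← map_smul, skelFam_normed]
    have h1 := finrank_range_vert b (fun k => k.1.1.target) hbν i
    rw [finrank_range_vert b' Sigma.fst hb' i, card_topIdx_fiber] at h1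
    have h2 : {p ∈ layer σ l | p.target = i} =
        Set.range fun k : {k : {p : σ // p.1.path.length = l} // k.1.1.target = i} =>
          k.1.1.1 := by
      ext p
      constructor
      · rintro ⟨⟨h1, h2⟩, h3⟩
        exact ⟨⟨⟨⟨p, h1⟩, h2⟩, h3⟩, rfl⟩
      · rintro ⟨k, rfl⟩
        exact ⟨⟨k.1.1.2, k.1.2⟩, k.2⟩
    have h3 : Function.Injective
        fun k : {k : {p : σ // p.1.path.length = l} // k.1.1.target = i} => k.1.1.1 :=
      fun k k' h => Subtype.ext (Subtype.ext (Subtype.ext h))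
    rw [h2, ← (Set.finite_range _).cast_ncard_eq, ← Nat.card_coe_set_eq,
      Nat.card_range_of_injective h3, ← h1]
  have hskel : IsSkeleton L (S 0) σ := by
    refine ⟨hlen, fun i => ?_, fun r j k p₁ p₂ h => ?_⟩
    · refine Eq.trans ?_ (hcomp 0 i)
      have h2 : {p ∈ layer σ (0 : Fin (L + 1)) | p.target = i} =
          HatPath.nil '' {r : TopIdx m | HatPath.nil r ∈ σ ∧ r.1 = i} := by
        ext p
        constructor
        · rintro ⟨⟨h1, h2⟩, h3⟩
          have h4 := h1.2
          rw [h2] at h4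
          obtain ⟨r, rfl⟩ := hτ0 h4
          exact ⟨r, ⟨h1, h3⟩, rfl⟩
        · rintro ⟨r, ⟨h1, h2⟩, rfl⟩
          exact ⟨⟨h1, rfl⟩, h2⟩
      rw [h2, Function.Injective.encard_image]
      intro r s h
      exact congrArg HatPath.idx h
    · induction p₂ with
      | nil => exact h
      | cons p₂ e ih =>
        refine ih ⟨?_, ?_⟩
        · have := h.1
          simp only [Quiver.Path.comp_cons, Quiver.Path.length_cons] at this ⊢
          omega
        · exact mem_of_cons_mem_arrowExtension (hτs _ h.2)
  refine ⟨σ, hskel, hcomp, (isDistinguished_iff hI hL hskel hcomp).2 ⟨hlay, ?_⟩⟩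
  exact span_eq_top_of_layer (radPow_eq_bot_of_nilpotencyClass hL) (ℓ := fun p : σ =>
    p.1.path.length) fun l hl => hL2 ⟨l, Nat.lt_succ_of_le hl⟩

end Equivalence

/-! ### Big Schubert cells, and finiteness of dimensions -/

section SchubertCells

variable {K W X κ : Type*} [Field K] [AddCommGroup W] [Module K W] [AddCommGroup X] [Module K X]

/-- If `C` is a complement of the span of `v` in `W₀`, then `v` spans `W₀ / C`; the quotient map is
replaced by any linear map with kernel `C`. -/
theorem span_image_of_mem_schubertCell {C W₀ : Submodule K W} {v : κ → W}
    (h : C ∈ schubertCell W₀ v) (q : W →ₗ[K] X) (hq : LinearMap.ker q = C) :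
    Submodule.span K (Set.range fun k => q (v k)) = W₀.map q := by
  have h1 : (Set.range fun k => q (v k)) = q '' Set.range v := by
    ext x; simp
  rw [← h.2.2, Submodule.map_sup, ← hq, h1, ← Submodule.map_span]
  have h2 : (LinearMap.ker q).map q = ⊥ := by
    rw [eq_bot_iff]
    rintro _ ⟨x, hx, rfl⟩
    exact hx
  rw [h2, bot_sup_eq]

theorem mem_schubertCell_of_basis {C W₀ : Submodule K W} {v : κ → W} (hC : C ≤ W₀)
    (q : W →ₗ[K] X) (hq : LinearMap.ker q = C) (hv : LinearIndependent K fun k => q (v k))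
    (hs : Submodule.span K (Set.range fun k => q (v k)) = W₀.map q) :
    C ∈ schubertCell W₀ v := by
  have h1 : (Set.range fun k => q (v k)) = q '' Set.range v := by
    ext x; simp
  rw [h1, ← Submodule.map_span] at hs
  refine ⟨LinearIndependent.of_comp q hv, ?_, ?_⟩
  · rw [← hq, inf_comm, ← disjoint_iff]
    exact Submodule.range_ker_disjoint hv
  · have h2 := congrArg (Submodule.comap q) hs
    rw [Submodule.comap_map_eq, Submodule.comap_map_eq, hq, sup_eq_left.2 hC] at h2
    rw [sup_comm, h2]

/-- Inside a Grassmannian of subspaces of `W₀`, a big Schubert cell is the non-vanishing locus of a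
single Plücker coordinate. -/
theorem exists_isOpen_schubertCell [Module.Finite K W] (W₀ : Submodule K W) (v : κ → W) (k : ℕ) :
    ∃ U : Set (Submodule K W), (zariskiGr K W).IsOpen U ∧
      ∀ C ≤ W₀, Module.finrank K C = k → (C ∈ schubertCell W₀ v ↔ C ∈ U) := by
  -- if the cell is not empty, then `v` spans a subspace of dimension `dim W₀ - k`, and the coordinate
  -- is the determinant of the projection from `C` to a fixed point `C₁` of the cell
  by_cases h : ∃ C ≤ W₀, Module.finrank K C = k ∧ C ∈ schubertCell W₀ v
  swap
  · refine ⟨∅, @isOpen_empty _ (zariskiGr K W), fun C hC hk => ⟨fun hs => h ⟨C, hC, hk, hs⟩, ?_⟩⟩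
    exact False.elim
  obtain ⟨C₁, hC₁, hk₁, hv, hinf, hsup⟩ := h
  set N := Submodule.span K (Set.range v) with hN
  -- a complement of `C₁` containing all `v j`; it meets `W₀` in their span
  obtain ⟨N', hNN', hN'⟩ : ∃ N', N ≤ N' ∧ IsCompl C₁ N' := by
    obtain ⟨D, hD⟩ := exists_isCompl (C₁ ⊔ N)
    refine ⟨N ⊔ D, le_sup_left, ?_, ?_⟩
    · exact (disjoint_iff.2 hinf).disjoint_sup_right_of_disjoint_sup_left hD.disjoint
    · rw [codisjoint_iff, ← sup_assoc, hD.sup_eq_top]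
  have hinfN : W₀ ⊓ N' = N := by
    rw [← hsup, sup_comm, sup_inf_assoc_of_le _ hNN', hN'.inf_eq_bot, sup_bot_eq]
  let b : Module.Basis (Fin k) K C₁ := Module.finBasisOfFinrankEq K C₁ hk₁
  let g : W →ₗ[K] C₁ := Submodule.projectionOnto C₁ N' hN'
  have hg : LinearMap.ker g = N' := Submodule.ker_projectionOnto hN'
  let ω : W [⋀^Fin k]→ₗ[K] K := b.det.compLinearMap g
  refine ⟨{C | ∃ c : Module.Basis (Fin k) K C, MvPolynomial.eval
    (fun ω : W [⋀^Fin k]→ₗ[K] K => ω fun j => (c j : W)) (MvPolynomial.X ω) ≠ 0},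
    TopologicalSpace.isOpen_generateFrom_of_mem
      ⟨k, 1, MvPolynomial.X ω, MvPolynomial.isHomogeneous_X K ω, rfl⟩, fun C hC hk => ?_⟩
  have hCN : C ⊓ N' = C ⊓ N := by
    rw [← hinfN, ← inf_assoc, inf_eq_left.2 hC]
  have hdet : ∀ c : Module.Basis (Fin k) K C,
      MvPolynomial.eval (fun ω : W [⋀^Fin k]→ₗ[K] K => ω fun j => (c j : W))
        (MvPolynomial.X ω) = b.det fun j => g (c j) := by
    intro c
    rw [MvPolynomial.eval_X]
    rfl
  simp only [Set.mem_ofPred_eq, hdet]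
  constructor
  · rintro ⟨-, hCN0, -⟩
    let c : Module.Basis (Fin k) K C := Module.finBasisOfFinrankEq K C hk
    refine ⟨c, ?_⟩
    have hc : LinearIndependent K fun j => (c j : W) :=
      c.linearIndependent.map' C.subtype C.ker_subtype
    have hspan : Submodule.span K (Set.range fun j => (c j : W)) = C := by
      have h1 : (Set.range fun j => (c j : W)) = C.subtype '' Set.range c := by
        ext x; simp
      rw [h1, ← Submodule.map_span, c.span_eq, Submodule.map_top, Submodule.range_subtype]
    have hgc : LinearIndependent K fun j => g (c j) := by
      refine hc.map ?_
      rw [hspan, hg, disjoint_iff, hCN]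
      exact hCN0
    refine ((b.is_basis_iff_det).1 ⟨hgc, ?_⟩).ne_zero
    exact hgc.span_eq_top_of_card_eq_finrank' (by rw [hk₁, Fintype.card_fin])
  · rintro ⟨c, hc⟩
    have hgc := ((b.is_basis_iff_det).2 (isUnit_iff_ne_zero.2 hc)).1
    have h0 : C ⊓ N = ⊥ := by
      rw [← hCN, eq_bot_iff]
      rintro x ⟨hxC, hxN⟩
      have hx : g x = 0 := by
        rw [← LinearMap.mem_ker, hg]
        exact hxN
      have h1 : x = ∑ j, c.repr ⟨x, hxC⟩ j • (c j : W) := by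
        refine (congrArg Subtype.val (c.sum_repr ⟨x, hxC⟩)).symm.trans ?_
        simp only [Submodule.coe_sum, Submodule.coe_smul]
      have h2 : ∑ j, c.repr ⟨x, hxC⟩ j • g (c j) = 0 := by
        rw [← hx]
        conv_rhs => rw [h1]
        simp
      have h3 := Fintype.linearIndependent_iff.1 hgc _ h2
      rw [Submodule.mem_bot, h1]
      simp [h3]
    refine ⟨hv, h0, ?_⟩
    refine Submodule.eq_of_le_of_finrank_eq (sup_le hC ?_) ?_
    · rw [← hsup]
      exact le_sup_right
    · change Module.finrank K ↥(C ⊔ N) = Module.finrank K W₀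
      have h1 := Submodule.finrank_sup_add_finrank_inf_eq C N
      have h2 := Submodule.finrank_sup_add_finrank_inf_eq C₁ N
      rw [h0] at h1
      rw [hinf, hsup] at h2
      rw [finrank_bot] at h1 h2
      omega

end SchubertCells

section Finiteness

theorem finite_paths_of_length_lt (V : Type u) [Finite V] [Quiver.{v} V]
    [∀ i j : V, Finite (i ⟶ j)] (n : ℕ) : {q : QPath V | q.2.2.length < n}.Finite := by
  induction n with
  | zero => simp
  | succ n ih =>
    have := ih.to_subtype
    let f : (Σ q : {q : QPath V | q.2.2.length < n}, Σ k : V, (q.1.2.1 ⟶ k)) → QPath V :=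
      fun x => ⟨x.1.1.1, x.2.1, x.1.1.2.2.cons x.2.2⟩
    refine ((Set.finite_range f).union (Set.finite_range fun i : V =>
      (⟨i, i, Quiver.Path.nil⟩ : QPath V))).subset ?_
    rintro ⟨i, j, p⟩ hp
    cases p with
    | nil => exact Or.inr ⟨i, rfl⟩
    | @cons k _ p e =>
      exact Or.inl ⟨⟨⟨⟨i, k, p⟩, Nat.lt_of_succ_lt_succ hp⟩, j, e⟩, rfl⟩

variable {K : Type w} {V : Type u} [Field K] [Fintype V] [Quiver.{v} V]
variable {I : Ideal (PathAlgebra K V)} [I.IsTwoSided]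

/-- `Λ` is finite dimensional: the paths of bounded length span it. -/
theorem finite_boundAlg [∀ i j : V, Finite (i ⟶ j)] (hI : IsAdmissible I) :
    Module.Finite K (BoundAlg I) := by
  obtain ⟨n, hn⟩ := exists_pathSpan_eq_bot hI
  have h : Submodule.span K ((fun q : QPath V => pathClass I q.2.2) ''
      {q : QPath V | q.2.2.length < n}) = ⊤ := by
    rw [eq_top_iff, ← pathSpan_zero I, pathSpan, Submodule.span_le]
    rintro _ ⟨i, j, p, -, rfl⟩
    by_cases hp : p.length < n
    · exact Submodule.subset_span ⟨⟨i, j, p⟩, hp, rfl⟩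
    · have h0 := pathClass_mem_pathSpan (I := I) p (not_lt.1 hp)
      rw [hn, Submodule.mem_bot] at h0
      rw [h0]
      exact Submodule.zero_mem _
  exact ⟨h ▸ Submodule.fg_span ((finite_paths_of_length_lt V n).image _)⟩

theorem finite_projMod [∀ i j : V, Finite (i ⟶ j)] (hI : IsAdmissible I) (m : V → ℕ) :
    Module.Finite K (ProjMod I m) := by
  have := finite_boundAlg hI
  have : ∀ i, Module.Finite K (Ideal.span {vert I i} : Ideal (BoundAlg I)) := fun i =>
    inferInstanceAs (Module.Finite K
      ((Ideal.span {vert I i} : Ideal (BoundAlg I)).restrictScalars K))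
  exact Module.Finite.pi

end Finiteness

/-! ### The charts of the strata -/

section Strata

variable {K : Type w} {V : Type u} [Field K] [Fintype V] [Quiver.{v} V]
variable {I : Ideal (PathAlgebra K V)} [I.IsTwoSided]

local instance : Ring (BoundAlg I) := inferInstance
local instance : Semiring (BoundAlg I) := inferInstance
local instance : AddCommGroup (BoundAlg I) := inferInstance

variable {L : ℕ} {S : Fin (L + 1) → V → ℕ} {d : V → ℕ}

theorem map_mkQ_jacobson {m : V → ℕ} (C : Submodule (BoundAlg I) (ProjMod I m)) :
    ((Ring.jacobson (BoundAlg I) • ⊤ : Submodule (BoundAlg I) (ProjMod I m)).restrictScalars K).map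
      (C.mkQ.restrictScalars K) =
      (radPow (BoundAlg I) (ProjMod I m ⧸ C) 1).restrictScalars K := by
  rw [← radPow_map C.mkQ C.mkQ_surjective, radPow_one]
  rfl

theorem ker_mkQ_restrictScalars {m : V → ℕ} (C : Submodule (BoundAlg I) (ProjMod I m)) :
    LinearMap.ker (C.mkQ.restrictScalars K) = C.restrictScalars K := by
  rw [LinearMap.ker_restrictScalars, Submodule.ker_mkQ]

theorem hasDimVec_of_adapted {m : V → ℕ} {σ : Set (HatPath m)}
    {C : Submodule (BoundAlg I) (ProjMod I m)} (hsum : ∀ i, ∑ l, S l i = d i)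
    (hσ : ∀ p ∈ σ, p.path.length ≤ L) (hS : Compatible S σ)
    (hv : LinearIndependent K (skelFam σ C))
    (hspan : Submodule.span K (Set.range (skelFam σ C)) = ⊤) :
    HasDimVec I (ProjMod I m ⧸ C) d := by
  have := (hS.finite hσ).to_subtype
  exact hasDimVec_of_basis skelFam_normed hv hspan fun i =>
    (card_target_eq_sum hσ hS i).trans (hsum i)

/-- In the small scenario, a skeleton contains all the distinguished top elements. -/
theorem IsSkeleton.nil_mem_small {V : Type*} [Quiver V] {t : V → ℕ} {σ : Set (HatPath t)}
    (hσ : IsSkeleton L t σ) (r : TopIdx t) : HatPath.nil r ∈ σ := by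
  have hfin : {s : TopIdx t | s.1 = r.1}.encard = t r.1 := by
    have : Finite {s : TopIdx t // s.1 = r.1} := Finite.of_equiv _ (Equiv.sigmaSubtype r.1).symm
    have hf : {s : TopIdx t | s.1 = r.1}.Finite := Set.finite_coe_iff.1 this
    rw [← hf.cast_ncard_eq, ← Nat.card_coe_set_eq]
    exact congrArg _ (card_topIdx_fiber t r.1)
  have hsub : {s : TopIdx t | HatPath.nil s ∈ σ ∧ s.1 = r.1} ⊆ {s : TopIdx t | s.1 = r.1} :=
    fun s hs => hs.2
  have h := (Set.finite_of_encard_eq_coe hfin).eq_of_subset_of_encard_le' hsub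
    (by rw [hfin, hσ.tops])
  have h2 : r ∈ {s : TopIdx t | HatPath.nil s ∈ σ ∧ s.1 = r.1} := by
    rw [h]
    rfl
  exact h2.1

theorem smallGrassSkel_eq [Module.Finite K (ProjMod I (S 0))] (hI : IsAdmissible I)
    (hL : nilpotencyClass (Ring.jacobson (BoundAlg I)) = L + 1)
    (hsum : ∀ i, ∑ l, S l i = d i) {σ : Set (HatPath (S 0))} (hσ : IsSkeleton L (S 0) σ)
    (hS : Compatible S σ) :
    smallGrassSkel I L (S 0) d σ = smallGrass I d S ∩ smallSchu I (S 0) d σ := by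
  ext C
  let ι : {p : HatPath (S 0) // p ∈ σ ∧ 0 < p.path.length} → σ := fun p => ⟨p.1, p.2.1⟩
  have hι : (Set.range fun p => skelFam σ C (ι p)) = skelFam σ C '' {p | 1 ≤ p.1.path.length} := by
    ext x
    constructor
    · rintro ⟨p, rfl⟩
      exact ⟨ι p, p.2.2, rfl⟩
    · rintro ⟨p, hp, rfl⟩
      exact ⟨⟨p.1, p.2, hp⟩, rfl⟩
  constructor
  · rintro ⟨hC, hdist⟩
    obtain ⟨hlay, hspan⟩ := (isDistinguished_iff hI hL hσ hS).1 hdist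
    obtain ⟨hv, hF⟩ := skelFam_adapted hI hL hσ.length_le hS hlay hspan
    have hdim := hasDimVec_of_adapted hsum hσ.length_le hS hv hspan
    refine ⟨⟨⟨hC, hdim⟩, hlay⟩, ⟨hC, hdim⟩, ?_⟩
    refine mem_schubertCell_of_basis hC.1 (C.mkQ.restrictScalars K) (ker_mkQ_restrictScalars C) ?_ ?_
    · exact hv.comp ι fun p q h => Subtype.ext (congrArg (fun x => x.1) h)
    · rw [map_mkQ_jacobson, hF 1, ← hι]
      rfl
  · rintro ⟨⟨⟨hC, -⟩, hlay⟩, -, hsch⟩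
    refine ⟨hC, (isDistinguished_iff hI hL hσ hS).2 ⟨hlay, ?_⟩⟩
    have h1 := span_image_of_mem_schubertCell hsch (C.mkQ.restrictScalars K)
      (ker_mkQ_restrictScalars C)
    rw [map_mkQ_jacobson] at h1
    -- the elements `z_r`, all of which belong to `σ`, span modulo the radical, and the paths of
    -- positive length span the radical
    rw [eq_top_iff, ← span_sup_radPow_one (K := K) hI (x := fun r => C.mkQ (topElt I (S 0) r))
      (ν := Sigma.fst) (fun r => by rw [← map_smul, vert_smul_topElt]) (span_mkQ_topElt C), ← h1]
    refine sup_le (Submodule.span_mono ?_) (Submodule.span_mono ?_)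
    · rintro _ ⟨r, rfl⟩
      refine ⟨⟨HatPath.nil r, hσ.nil_mem_small r⟩, ?_⟩
      change C.mkQ ((HatPath.nil r).toProj I) = C.mkQ (topElt I (S 0) r)
      rw [toProj_nil]
    · rintro _ ⟨p, rfl⟩
      exact ⟨ι p, rfl⟩

theorem bigGrassSkel_eq [Module.Finite K (ProjMod I d)] (hI : IsAdmissible I)
    (hL : nilpotencyClass (Ring.jacobson (BoundAlg I)) = L + 1)
    {σ : Set (HatPath d)} (hσ : IsSkeleton L (S 0) σ) (hS : Compatible S σ) :
    bigGrassSkel I L d σ = bigGrass I d S ∩ bigSchu I d σ := by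
  ext C
  have htop : (⊤ : Submodule K (ProjMod I d)).map (C.mkQ.restrictScalars K) = ⊤ := by
    rw [Submodule.map_top, LinearMap.range_eq_top]
    exact C.mkQ_surjective
  constructor
  · rintro ⟨hC, hdist⟩
    obtain ⟨hlay, hspan⟩ := (isDistinguished_iff hI hL hσ hS).1 hdist
    obtain ⟨hv, hF⟩ := skelFam_adapted hI hL hσ.length_le hS hlay hspan
    refine ⟨⟨hC, hlay⟩, hC, mem_schubertCell_of_basis le_top (C.mkQ.restrictScalars K)
      (ker_mkQ_restrictScalars C) hv ?_⟩
    rw [htop]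
    exact hspan
  · rintro ⟨⟨hC, hlay⟩, -, hsch⟩
    refine ⟨hC, (isDistinguished_iff hI hL hσ hS).2 ⟨hlay, ?_⟩⟩
    have h1 := span_image_of_mem_schubertCell hsch (C.mkQ.restrictScalars K)
      (ker_mkQ_restrictScalars C)
    rw [htop] at h1
    exact h1

/-- A set cut out of `X` by a big Schubert cell is open in `X`. -/
theorem isZariskiOpenIn_inter {A W κ : Type*} [Ring A] [Algebra K A] [AddCommGroup W] [Module K W]
    [Module A W] [IsScalarTower K A W] [Module.Finite K W] {X Y : Set (Submodule A W)}
    (W₀ : Submodule K W) (v : κ → W) (k : ℕ) (hX : ∀ C ∈ X, C.restrictScalars K ≤ W₀ ∧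
      Module.finrank K C = k)
    (hY : ∀ C, C ∈ Y ↔ C ∈ X ∧ C.restrictScalars K ∈ schubertCell W₀ v) :
    IsZariskiOpenIn K Y X := by
  obtain ⟨U, hU, h⟩ := exists_isOpen_schubertCell W₀ v k
  refine ⟨U, hU, Set.ext fun C => ?_⟩
  rw [hY]
  exact and_congr_right fun hC => h _ (hX C hC).1 (hX C hC).2

theorem isZariskiOpenIn_smallGrassSkel [Module.Finite K (ProjMod I (S 0))] (hI : IsAdmissible I)
    (hL : nilpotencyClass (Ring.jacobson (BoundAlg I)) = L + 1)
    (hsum : ∀ i, ∑ l, S l i = d i) {σ : Set (HatPath (S 0))} (hσ : IsSkeleton L (S 0) σ)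
    (hS : Compatible S σ) :
    IsZariskiOpenIn K (smallGrassSkel I L (S 0) d σ) (smallGrass I d S) := by
  refine isZariskiOpenIn_inter ((Ring.jacobson (BoundAlg I) • ⊤ :
      Submodule (BoundAlg I) (ProjMod I (S 0))).restrictScalars K)
    (fun p : {p : HatPath (S 0) // p ∈ σ ∧ 0 < p.path.length} => p.1.toProj I)
    (Module.finrank K (ProjMod I (S 0)) - ∑ i, d i) (fun C hC => ⟨hC.1.1.1, ?_⟩) fun C => ?_
  · have := hC.1.1.2
    omega
  · rw [smallGrassSkel_eq hI hL hsum hσ hS]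
    exact and_congr_right fun hC => and_iff_right hC.1

theorem isZariskiOpenIn_bigGrassSkel [Module.Finite K (ProjMod I d)] (hI : IsAdmissible I)
    (hL : nilpotencyClass (Ring.jacobson (BoundAlg I)) = L + 1)
    {σ : Set (HatPath d)} (hσ : IsSkeleton L (S 0) σ) (hS : Compatible S σ) :
    IsZariskiOpenIn K (bigGrassSkel I L d σ) (bigGrass I d S) := by
  refine isZariskiOpenIn_inter (⊤ : Submodule K (ProjMod I d))
    (fun p : σ => p.1.toProj I)
    (Module.finrank K (ProjMod I d) - ∑ i, d i) (fun C hC => ⟨le_top, ?_⟩) fun C => ?_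
  · have := hC.1.1
    omega
  · rw [bigGrassSkel_eq hI hL hσ hS]
    exact and_congr_right fun hC => and_iff_right hC.1

theorem iUnion_smallGrassSkel [Module.Finite K (ProjMod I (S 0))] (hI : IsAdmissible I)
    (hL : nilpotencyClass (Ring.jacobson (BoundAlg I)) = L + 1) (hsum : ∀ i, ∑ l, S l i = d i) :
    (⋃ σ ∈ {σ : Set (HatPath (S 0)) | IsSkeleton L (S 0) σ ∧ Compatible S σ},
      smallGrassSkel I L (S 0) d σ) = smallGrass I d S := by
  refine subset_antisymm (Set.iUnion₂_subset fun σ hσ => ?_) fun C hC => ?_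
  · rw [smallGrassSkel_eq hI hL hsum hσ.1 hσ.2]
    exact Set.inter_subset_left
  · obtain ⟨σ, h1, h2, h3⟩ := exists_isDistinguished hI hL hC.2
    exact Set.mem_iUnion₂.2 ⟨σ, ⟨h1, h2⟩, hC.1.1, h3⟩

theorem iUnion_bigGrassSkel [Module.Finite K (ProjMod I d)] (hI : IsAdmissible I)
    (hL : nilpotencyClass (Ring.jacobson (BoundAlg I)) = L + 1) :
    (⋃ σ ∈ {σ : Set (HatPath d) | IsSkeleton L (S 0) σ ∧ Compatible S σ},
      bigGrassSkel I L d σ) = bigGrass I d S := by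
  refine subset_antisymm (Set.iUnion₂_subset fun σ hσ => ?_) fun C hC => ?_
  · rw [bigGrassSkel_eq hI hL hσ.1 hσ.2]
    exact Set.inter_subset_left
  · obtain ⟨σ, h1, h2, h3⟩ := exists_isDistinguished hI hL hC.2
    exact Set.mem_iUnion₂.2 ⟨σ, ⟨h1, h2⟩, hC.1, h3⟩

end Strata

/-! ### Curves in Grassmannians, and radical layers of quotients -/

section Curves

variable {K W : Type*} [Field K] [AddCommGroup W] [Module K W]

open Polynomial in
/-- Along a line, the values of an alternating form are given by a polynomial. -/
theorem exists_polynomial_eval_alternating {k : ℕ} (ω : W [⋀^Fin k]→ₗ[K] K) (a b : Fin k → W) :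
    ∃ p : K[X], ∀ t : K, p.eval t = ω fun j => a j + t • b j := by
  classical
  refine ⟨∑ s : Finset (Fin k), C (ω (s.piecewise b a)) * X ^ s.card, fun t => ?_⟩
  have h1 : (fun j => a j + t • b j) = (fun j => t • b j) + a := by
    funext j
    exact add_comm _ _
  have h2 : ω ((fun j => t • b j) + a) = ∑ s : Finset (Fin k),
      ω (s.piecewise (fun j => t • b j) a) := ω.toMultilinearMap.map_add_univ _ _
  rw [h1, h2, eval_finsetSum]
  refine Finset.sum_congr rfl fun s _ => ?_
  have h3 : s.piecewise (fun j => t • b j) a =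
      s.piecewise (fun j => t • s.piecewise b a j) (s.piecewise b a) := by
    funext j
    by_cases hj : j ∈ s <;> simp [hj]
  have h4 : ω (s.piecewise (fun j => t • s.piecewise b a j) (s.piecewise b a)) =
      (∏ _j ∈ s, t) • ω (s.piecewise b a) :=
    ω.toMultilinearMap.map_piecewise_smul (fun _ => t) (s.piecewise b a) s
  rw [h3, h4, Finset.prod_const, smul_eq_mul, eval_mul, eval_C, eval_pow, eval_X, mul_comm]

/-- The curves `t ↦ (1 + t N) C` in a Grassmannian are continuous: the Plücker coordinates are
polynomials in `t`, so that an open set containing `C` contains `(1 + t N) C` for all but finitely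
many `t`. -/
theorem finite_map_notMem_of_isOpen {N : W →ₗ[K] W}
    (hN : ∀ t : K, Function.Injective (LinearMap.id + t • N : W →ₗ[K] W))
    {U : Set (Submodule K W)} (hU : (zariskiGr K W).IsOpen U) {C : Submodule K W} (hC : C ∈ U) :
    {t : K | C.map (LinearMap.id + t • N) ∉ U}.Finite := by
  induction hU with
  | basic U hU =>
    obtain ⟨k, n, F, -, rfl⟩ := hU
    obtain ⟨c, hc⟩ := hC
    choose p hp using fun ω : W [⋀^Fin k]→ₗ[K] K =>
      exists_polynomial_eval_alternating ω (fun j => (c j : W)) fun j => N (c j)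
    let G : Polynomial K := MvPolynomial.eval₂ Polynomial.C p F
    have hG : ∀ t, G.eval t = MvPolynomial.eval (fun ω : W [⋀^Fin k]→ₗ[K] K =>
        ω fun j => (c j : W) + t • N (c j)) F := by
      intro t
      have h := MvPolynomial.eval₂_comp_left (Polynomial.evalRingHom t) Polynomial.C p F
      rw [Polynomial.coe_evalRingHom] at h
      refine h.trans ?_
      rw [MvPolynomial.eval, MvPolynomial.coe_eval₂Hom]
      congr 1
      · ext x
        simp
      · funext ω
        exact hp ω t
    -- the value at `t = 0` is the one at `C`
    have hG0 : G ≠ 0 := by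
      intro h
      have h1 := hG 0
      simp only [zero_smul, add_zero] at h1
      rw [h, Polynomial.eval_zero] at h1
      exact hc h1.symm
    refine (Polynomial.finite_setOfPred_isRoot hG0).subset fun t ht => ?_
    by_contra hroot
    refine ht ⟨c.map (Submodule.equivMapOfInjective _ (hN t) C), ?_⟩
    intro h0
    refine hroot ?_
    change G.eval t = 0
    rw [hG, ← h0]
    rfl
  | univ => simp
  | inter U₁ U₂ _ _ h₁ h₂ =>
    refine ((h₁ hC.1).union (h₂ hC.2)).subset fun t ht => ?_
    by_contra h
    simp only [Set.mem_union, Set.mem_ofPred_eq, not_or, not_not] at h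
    exact ht h
  | sUnion 𝒰 _ ih =>
    obtain ⟨U, hU, hCU⟩ := hC
    exact (ih U hU hCU).subset fun t ht h => ht ⟨U, hU, h⟩

/-- A subset of `X` which meets a curve `t ↦ (1 + t N) C` in `X` at the parameter `0` only is not
open in `X`. -/
theorem not_isZariskiOpenIn_of_curve [Infinite K] {A : Type*} [Ring A] [Algebra K A] [Module A W]
    [IsScalarTower K A W] {N : W →ₗ[K] W}
    (hN : ∀ t : K, Function.Injective (LinearMap.id + t • N : W →ₗ[K] W))
    {C : K → Submodule A W} (hC : ∀ t, ((C 0).restrictScalars K).map (LinearMap.id + t • N) =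
      (C t).restrictScalars K)
    {X Y : Set (Submodule A W)} (h0 : C 0 ∈ Y) (hX : ∀ t, C t ∈ X) (hY : ∀ t ≠ 0, C t ∉ Y) :
    ¬ IsZariskiOpenIn K Y X := by
  rintro ⟨U, hU, rfl⟩
  have hfin := (finite_map_notMem_of_isOpen hN hU h0.2).union (Set.finite_singleton (0 : K))
  obtain ⟨t, ht⟩ := hfin.exists_notMem
  simp only [Set.mem_union, Set.mem_ofPred_eq, not_or, not_not, Set.mem_singleton_iff] at ht
  rw [hC] at ht
  exact hY t ht.2 ⟨hX t, ht.1⟩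

end Curves

section QuotientLayers

variable {K : Type w} {V : Type u} [Field K] [Fintype V] [Quiver.{v} V]
variable {I : Ideal (PathAlgebra K V)} [I.IsTwoSided]
variable {M : Type*} [AddCommGroup M] [Module K M] [Module (BoundAlg I) M]
  [IsScalarTower K (BoundAlg I) M]
variable {N : Type*} [AddCommGroup N] [Module K N] [Module (BoundAlg I) N]
  [IsScalarTower K (BoundAlg I) N]

theorem exists_surjective_radLayer {A M N : Type*} [Ring A] [AddCommGroup M] [Module A M]
    [AddCommGroup N] [Module A N] (f : M →ₗ[A] N) (hf : Function.Surjective f) (l : ℕ) :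
    ∃ g : radLayer A M l →ₗ[A] radLayer A N l, Function.Surjective g := by
  have h : radPow A M (l + 1) ≤ (radPow A N (l + 1)).comap f := by
    rw [← radPow_map f hf]
    exact Submodule.le_comap_map _ _
  have h2 : ∀ x ∈ radLayer A M l, Submodule.mapQ _ _ f h x ∈ radLayer A N l := by
    rintro _ ⟨y, hy, rfl⟩
    exact ⟨f y, radPow_map f hf l ▸ Submodule.mem_map_of_mem hy, rfl⟩
  refine ⟨(Submodule.mapQ _ _ f h).restrict h2, ?_⟩
  rintro ⟨_, y, hy, rfl⟩
  rw [SetLike.mem_coe, ← radPow_map f hf] at hy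
  obtain ⟨x, hx, rfl⟩ := hy
  exact ⟨⟨_, x, hx, rfl⟩, rfl⟩

/-- The radical layers of a quotient embed into those of the module. -/
theorem HasRadLayering.exists_injective (hI : IsAdmissible I) {L : ℕ} {S : Fin (L + 1) → V → ℕ}
    (h : HasRadLayering I N S) (f : M →ₗ[BoundAlg I] N) (hf : Function.Surjective f)
    (l : Fin (L + 1)) :
    ∃ g : SemisimpleMod I (S l) →ₗ[BoundAlg I] radLayer (BoundAlg I) M l,
      Function.Injective g := by
  obtain ⟨g, hg⟩ := exists_surjective_radLayer f hf l
  exact exists_injective_of_surjective (K := K) hI (fun a ha x => jacobson_smul_radLayer ha x) g hg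
    (h l)

theorem jacobson_pow_le_pathSpan (hI : IsAdmissible I) (n : ℕ) :
    (Ring.jacobson (BoundAlg I) ^ n).restrictScalars K ≤ pathSpan I n := by
  induction n with
  | zero =>
    rw [pathSpan_zero]
    exact le_top
  | succ n ih =>
    intro a ha
    rw [Submodule.restrictScalars_mem, Submodule.pow_succ] at ha
    refine Submodule.mul_induction_on (C := fun a => a ∈ pathSpan I (n + 1)) ha
      (fun b hb c hc => ?_) fun b c => add_mem
    exact pathSpan_mul_le I n 1
      (Submodule.mul_mem_mul (ih hb) ((mem_jacobson_iff_mem_pathSpan hI c).1 hc))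

end QuotientLayers

/-! ### The triangle quiver and a curve of submodules -/

/-- The vertices of the quiver with arrows `a : source ⟶ middle`, `b : middle ⟶ sink` and
`c : source ⟶ sink`. -/
inductive TriVertex : Type
  | source
  | middle
  | sink
  deriving DecidableEq

/-- The arrows of the triangle quiver. -/
inductive TriArrow : TriVertex → TriVertex → Type
  | a : TriArrow .source .middle
  | b : TriArrow .middle .sink
  | c : TriArrow .source .sink

namespace TriVertex

instance : Fintype TriVertex := ⟨{source, middle, sink}, fun i => by cases i <;> simp⟩

instance : Quiver.{0} TriVertex := ⟨TriArrow⟩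

instance (i j : TriVertex) : Finite (i ⟶ j) := by
  have : Subsingleton (i ⟶ j) := ⟨fun (e f : TriArrow i j) => by
    cases e <;> cases f <;> rfl⟩
  infer_instance

/-- The position of a vertex in the linear order `source < middle < sink`. -/
def rank : TriVertex → ℕ
  | source => 0
  | middle => 1
  | sink => 2

theorem rank_add_length_le {i j : TriVertex} (p : Quiver.Path i j) :
    rank i + p.length ≤ rank j := by
  induction p with
  | nil => exact le_rfl
  | cons p e ih =>
    rw [Quiver.Path.length_cons]
    have h : ∀ {k l : TriVertex} (e : k ⟶ l), rank k + 1 ≤ rank l := by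
      intro k l (e : TriArrow k l)
      cases e <;> simp [rank]
    have := h e
    omega

theorem rank_le_two (i : TriVertex) : rank i ≤ 2 := by
  cases i <;> simp [rank]

theorem length_lt_three {i j : TriVertex} (p : Quiver.Path i j) : p.length < 3 := by
  have h := rank_add_length_le p
  have h2 := rank_le_two j
  omega

theorem sum_eq {α : Type*} [AddCommMonoid α] (f : TriVertex → α) :
    ∑ i, f i = f source + f middle + f sink := by
  change ∑ i ∈ {source, middle, sink}, f i = _
  rw [Finset.sum_insert (by decide), Finset.sum_insert (by decide), Finset.sum_singleton, add_assoc]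

/-- The path of length two from the source to the sink. -/
def longPath : Quiver.Path source sink := (Quiver.Path.nil.cons TriArrow.a).cons TriArrow.b

/-- The arrow `a`, as a path. -/
def aPath : Quiver.Path source middle := Quiver.Path.nil.cons TriArrow.a

/-- The arrow `b`, as a path. -/
def bPath : Quiver.Path middle sink := Quiver.Path.nil.cons TriArrow.b

/-- The arrow `c`, as a path. -/
def cPath : Quiver.Path source sink := Quiver.Path.nil.cons TriArrow.c

/-- The shortest path from the source to a given vertex. -/
def pathTo : (i : TriVertex) → Quiver.Path source i
  | source => Quiver.Path.nil
  | middle => aPath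
  | sink => cPath

/-- The paths starting in the source are `e`, `a`, `c` and `b a`. -/
theorem path_source_cases {P : (j : TriVertex) → Quiver.Path source j → Prop}
    (h0 : P source Quiver.Path.nil) (ha : P middle aPath) (hc : P sink cPath)
    (hl : P sink longPath) {j : TriVertex} (p : Quiver.Path source j) : P j p := by
  have no_arrow : ∀ {j : TriVertex} (e : j ⟶ source), False := by
    intro j (e : TriArrow j source)
    cases e
  cases p with
  | nil => exact h0
  | @cons k _ p e =>
    change TriArrow k j at e
    cases e with
    | a =>
      cases p with
      | nil => exact ha
      | cons p e => exact (no_arrow e).elim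
    | c =>
      cases p with
      | nil => exact hc
      | cons p e => exact (no_arrow e).elim
    | b =>
      cases p with
      | @cons k _ p e =>
        change TriArrow k middle at e
        cases e
        cases p with
        | nil => exact hl
        | cons p e => exact (no_arrow e).elim

/-- The sequence `S` with the simple module at the source on top, and the two other simple modules
in the next layer. -/
def layerSeq (l : Fin 3) (i : TriVertex) : ℕ := if min (rank i) 1 = l then 1 else 0

end TriVertex

open TriVertex

section Triangle

variable (K : Type w) [Field K]

/-- The zero ideal of the path algebra of the triangle quiver. -/
abbrev triIdeal : Ideal (PathAlgebra K TriVertex) := ⊥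

local instance : Ring (BoundAlg (triIdeal K)) := inferInstance
local instance : Semiring (BoundAlg (triIdeal K)) := inferInstance
local instance : AddCommGroup (BoundAlg (triIdeal K)) := inferInstance

theorem isAdmissible_triIdeal : IsAdmissible (triIdeal K) := by
  refine ⟨fun x hx => ?_, 3, ?_⟩
  · rw [Submodule.restrictScalars_mem, Ideal.mem_bot] at hx
    rw [hx]
    exact Submodule.zero_mem _
  · refine Submodule.span_le.2 ?_
    rintro _ ⟨i, j, p, hp, -⟩
    exact absurd (length_lt_three p) (by omega)

/-- The residue classes of the paths form a basis of `KΓ / 0`. -/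
def triBasis : Module.Basis (QPath TriVertex) K (BoundAlg (triIdeal K)) :=
  (Module.Basis.ofRepr (LinearEquiv.refl K (QPath TriVertex →₀ K)) :
    Module.Basis (QPath TriVertex) K (PathAlgebra K TriVertex)).map
    (LinearEquiv.ofBijective (Ideal.Quotient.mkₐ K (triIdeal K)).toLinearMap
      ⟨fun x y h => by
        have h2 := (Ideal.Quotient.eq (I := triIdeal K)).1 h
        exact sub_eq_zero.1 h2, Ideal.Quotient.mk_surjective⟩)

theorem triBasis_apply {i j : TriVertex} (p : Quiver.Path i j) :
    triBasis K ⟨i, j, p⟩ = pathClass (triIdeal K) p := rfl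

open Classical in
theorem triBasis_repr {i j : TriVertex} (p : Quiver.Path i j) (q : QPath TriVertex) :
    (triBasis K).repr (pathClass (triIdeal K) p) q =
      if (⟨i, j, p⟩ : QPath TriVertex) = q then 1 else 0 := by
  rw [← triBasis_apply, Module.Basis.repr_self, Finsupp.single_apply]

variable {K}

/-- The element `b a + t c`. -/
def linePt (t : K) : BoundAlg (triIdeal K) :=
  pathClass (triIdeal K) longPath + t • pathClass (triIdeal K) cPath

/-- The left ideal generated by `b a + t c` is a line, because no arrow starts in the sink. -/
theorem mem_span_linePt {t : K} {x : BoundAlg (triIdeal K)} :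
    x ∈ (Ideal.span {linePt t} : Ideal (BoundAlg (triIdeal K))) ↔ ∃ s : K, x = s • linePt t := by
  constructor
  · intro hx
    obtain ⟨a, rfl⟩ := Ideal.mem_span_singleton'.1 hx
    have hle : pathSpan (triIdeal K) 0 ≤ (Submodule.span K {linePt t}).comap
        (LinearMap.mulRight K (linePt t)) := by
      refine Submodule.span_le.2 ?_
      rintro _ ⟨i, j, p, -, rfl⟩
      change pathClass (triIdeal K) p * linePt t ∈ Submodule.span K {linePt t}
      rw [linePt, mul_add, mul_smul_comm]
      by_cases hi : sink = i
      · subst hi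
        cases p with
        | nil =>
          rw [pathClass_nil, vert_mul_pathClass, vert_mul_pathClass]
          exact Submodule.mem_span_singleton_self _
        | cons p e =>
          -- no arrow starts in the sink
          have h1 := rank_add_length_le (p.cons e)
          have h2 := rank_le_two j
          rw [Quiver.Path.length_cons, rank] at h1
          omega
      · rw [pathClass_mul_of_ne _ _ _ hi, pathClass_mul_of_ne _ _ _ hi, smul_zero, add_zero]
        exact Submodule.zero_mem _
    have h := hle (show a ∈ pathSpan (triIdeal K) 0 by rw [pathSpan_zero]; trivial)
    obtain ⟨s, hs⟩ := Submodule.mem_span_singleton.1 h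
    exact ⟨s, hs.symm⟩
  · rintro ⟨s, rfl⟩
    exact Submodule.smul_of_tower_mem _ s (Ideal.subset_span rfl)

variable {m : TriVertex → ℕ} (k : Fin (m source))

/-- The index of a distinguished top element normed by the source. -/
abbrev srcIdx : TopIdx m := ⟨source, k⟩

variable (K) in
/-- The component at the index `(source, k)`. -/
def srcComp : ProjMod (triIdeal K) m →ₗ[BoundAlg (triIdeal K)] BoundAlg (triIdeal K) :=
  (Ideal.span {vert (triIdeal K) source} : Ideal (BoundAlg (triIdeal K))).subtype ∘ₗ
    LinearMap.proj (srcIdx k)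

/-- The points of a curve: `C_t` consists of the elements whose component at a fixed index
`(source, k)` is a multiple of `b a + t c`. -/
def curvePt (t : K) : Submodule (BoundAlg (triIdeal K)) (ProjMod (triIdeal K) m) :=
  Submodule.comap (srcComp K k) (Ideal.span {linePt t})

theorem mem_curvePt {t : K} {q : ProjMod (triIdeal K) m} :
    q ∈ curvePt k t ↔ ∃ s : K, srcComp K k q = s • linePt t := mem_span_linePt

theorem srcComp_topElt : srcComp K k (topElt (triIdeal K) m (srcIdx k)) = vert _ source :=
  congrArg Subtype.val (topElt_self m (srcIdx k))

theorem srcComp_smul_topElt {j : TriVertex} (p : Quiver.Path source j) :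
    srcComp K k (pathClass (triIdeal K) p • topElt (triIdeal K) m (srcIdx k)) =
      pathClass (triIdeal K) p := by
  rw [map_smul, srcComp_topElt, smul_eq_mul, pathClass_mul_vert]

theorem srcComp_smul_smul (c : K) {j : TriVertex} (p : Quiver.Path source j) :
    srcComp K k (c • pathClass (triIdeal K) p • topElt (triIdeal K) m (srcIdx k)) =
      c • pathClass (triIdeal K) p := by
  rw [LinearMap.map_smul_of_tower, srcComp_smul_topElt]

theorem srcComp_mul_vert (q : ProjMod (triIdeal K) m) :
    srcComp K k q * vert (triIdeal K) source = srcComp K k q := by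
  obtain ⟨a, ha⟩ := Ideal.mem_span_singleton'.1 (q (srcIdx k)).2
  have ha' : a * vert (triIdeal K) source = srcComp K k q := ha
  rw [← ha', mul_assoc, vert_mul_self]

variable (K) in
/-- The nilpotent endomorphism sending `b a z` to `c z` and the other paths to zero. -/
def nilEnd : ProjMod (triIdeal K) m →ₗ[K] ProjMod (triIdeal K) m :=
  (((triBasis K).coord ⟨source, sink, longPath⟩) ∘ₗ (srcComp K k).restrictScalars K).smulRight
    (pathClass (triIdeal K) cPath • topElt (triIdeal K) m (srcIdx k))

theorem cPath_ne_longPath : cPath ≠ longPath := by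
  intro h
  have := congrArg Quiver.Path.length h
  simp [cPath, longPath] at this

theorem coord_longPath_cPath :
    (triBasis K).coord ⟨source, sink, longPath⟩ (pathClass (triIdeal K) cPath) = 0 := by
  rw [Module.Basis.coord_apply, triBasis_repr]
  simp [cPath_ne_longPath]

theorem coord_longPath_linePt (t : K) :
    (triBasis K).coord ⟨source, sink, longPath⟩ (linePt t) = 1 := by
  rw [linePt, map_add, map_smul, coord_longPath_cPath, Module.Basis.coord_apply, triBasis_repr]
  simp

theorem nilEnd_apply (q : ProjMod (triIdeal K) m) :
    nilEnd K k q = (triBasis K).coord ⟨source, sink, longPath⟩ (srcComp K k q) •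
      pathClass (triIdeal K) cPath • topElt (triIdeal K) m (srcIdx k) := rfl

theorem srcComp_nilEnd (q : ProjMod (triIdeal K) m) :
    srcComp K k (nilEnd K k q) = (triBasis K).coord ⟨source, sink, longPath⟩ (srcComp K k q) •
      pathClass (triIdeal K) cPath := by
  rw [nilEnd_apply, srcComp_smul_smul]

theorem nilEnd_nilEnd (q : ProjMod (triIdeal K) m) : nilEnd K k (nilEnd K k q) = 0 := by
  rw [nilEnd_apply, srcComp_nilEnd, map_smul, coord_longPath_cPath, smul_zero, zero_smul]

theorem injective_id_add_smul_nilEnd (t : K) :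
    Function.Injective (LinearMap.id + t • nilEnd K k : ProjMod (triIdeal K) m →ₗ[K] _) := by
  refine (injective_iff_map_eq_zero _).2 fun q hq => ?_
  have h : q + t • nilEnd K k q = 0 := hq
  have h2 : nilEnd K k (q + t • nilEnd K k q) = 0 := by rw [h, map_zero]
  rw [map_add, map_smul, nilEnd_nilEnd, smul_zero, add_zero] at h2
  rwa [h2, smul_zero, add_zero] at h

/-- The curve `C_t` is the translate of `C_0` by the unipotent maps `1 + t N`. -/
theorem map_curvePt (t : K) : ((curvePt (m := m) k (0 : K)).restrictScalars K).map
    (LinearMap.id + t • nilEnd K k) = (curvePt k t).restrictScalars K := by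
  ext q
  constructor
  · rintro ⟨q, hq, rfl⟩
    obtain ⟨s, hs⟩ := (mem_curvePt k).1 hq
    refine (mem_curvePt k).2 ⟨s, ?_⟩
    change srcComp K k (q + t • nilEnd K k q) = _
    rw [map_add, LinearMap.map_smul_of_tower, srcComp_nilEnd, hs, map_smul, coord_longPath_linePt,
      linePt, linePt, zero_smul, add_zero, smul_add, smul_eq_mul, mul_one, smul_comm]
  · intro hq
    obtain ⟨s, hs⟩ := (mem_curvePt k).1 hq
    refine ⟨q - t • nilEnd K k q, (mem_curvePt k).2 ⟨s, ?_⟩, ?_⟩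
    · rw [map_sub, LinearMap.map_smul_of_tower, srcComp_nilEnd, hs, map_smul,
        coord_longPath_linePt, linePt, linePt, zero_smul, add_zero, smul_add, smul_eq_mul, mul_one,
        smul_comm t s, add_sub_cancel_right]
    · change q - t • nilEnd K k q + t • nilEnd K k (q - t • nilEnd K k q) = q
      rw [map_sub, map_smul, nilEnd_nilEnd, smul_zero, sub_zero, sub_add_cancel]

end Triangle

/-! ### Radical layerings along the curve -/

section TriangleModules

variable {K : Type w} [Field K]

local instance : Ring (BoundAlg (triIdeal K)) := inferInstance
local instance : Semiring (BoundAlg (triIdeal K)) := inferInstance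
local instance : AddCommGroup (BoundAlg (triIdeal K)) := inferInstance

variable {m : TriVertex → ℕ} (k : Fin (m source))

/-- The generator of `Q / C_t`. -/
def curveGen (t : K) : ProjMod (triIdeal K) m ⧸ curvePt k t :=
  (curvePt k t).mkQ (topElt (triIdeal K) m (srcIdx k))

/-- The basis `x`, `a x`, `c x` of `Q / C_t`, where `x` is the generator. -/
def curveFam (t : K) (i : TriVertex) : ProjMod (triIdeal K) m ⧸ curvePt k t :=
  pathClass (triIdeal K) (pathTo i) • curveGen k t

theorem curveFam_normed (t : K) (i : TriVertex) :
    vert (triIdeal K) i • curveFam k t i = curveFam k t i :=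
  vert_smul_pathClass_smul _ _

theorem vert_smul_curveGen (t : K) : vert (triIdeal K) source • curveGen k t = curveGen k t := by
  rw [curveGen, ← map_smul]
  exact congrArg _ (vert_smul_topElt m (srcIdx k))

/-- In `Q / C_t`, the relation `b a x = - t c x` holds. -/
theorem longPath_smul_curveGen (t : K) :
    pathClass (triIdeal K) longPath • curveGen k t = -t • curveFam k t sink := by
  rw [neg_smul, eq_neg_iff_add_eq_zero]
  have h : pathClass (triIdeal K) longPath • curveGen k t + t • curveFam k t sink =
      (curvePt k t).mkQ (linePt t • topElt (triIdeal K) m (srcIdx k)) := by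
    rw [linePt, add_smul, smul_assoc, map_add, map_smul, LinearMap.map_smul_of_tower, map_smul]
    rfl
  rw [h, Submodule.mkQ_apply, Submodule.Quotient.mk_eq_zero]
  refine (mem_curvePt k).2 ⟨1, ?_⟩
  rw [linePt, add_smul, smul_assoc, map_add, srcComp_smul_topElt, srcComp_smul_smul, one_smul]

theorem span_curveFam (t : K) : Submodule.span K (Set.range (curveFam k t)) = ⊤ := by
  refine eq_top_iff.2 fun y _ => ?_
  obtain ⟨q, rfl⟩ := (curvePt k t).mkQ_surjective y
  have h : (curvePt k t).mkQ q = srcComp K k q • curveGen k t := by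
    rw [curveGen, ← map_smul, ← sub_eq_zero, ← map_sub, Submodule.mkQ_apply,
      Submodule.Quotient.mk_eq_zero]
    refine (mem_curvePt k).2 ⟨0, ?_⟩
    rw [map_sub, map_smul, srcComp_topElt, smul_eq_mul, srcComp_mul_vert, sub_self, zero_smul]
  rw [h]
  have hle : pathSpan (triIdeal K) 0 ≤ (Submodule.span K (Set.range (curveFam k t))).comap
      ((Algebra.lsmul K K (ProjMod (triIdeal K) m ⧸ curvePt k t)).toLinearMap.flip
        (curveGen k t)) := by
    refine Submodule.span_le.2 ?_
    rintro _ ⟨i, j, p, -, rfl⟩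
    change pathClass (triIdeal K) p • curveGen k t ∈ Submodule.span K (Set.range (curveFam k t))
    by_cases hi : source = i
    · subst hi
      refine path_source_cases (P := fun _ p => pathClass (triIdeal K) p • curveGen k t ∈
        Submodule.span K (Set.range (curveFam k t))) ?_ ?_ ?_ ?_ p
      · exact Submodule.subset_span ⟨source, rfl⟩
      · exact Submodule.subset_span ⟨middle, rfl⟩
      · exact Submodule.subset_span ⟨sink, rfl⟩
      · rw [longPath_smul_curveGen]
        exact Submodule.smul_mem _ _ (Submodule.subset_span ⟨sink, rfl⟩)
    · rw [pathClass_smul_of_ne (vert_smul_curveGen k t) p hi]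
      exact Submodule.zero_mem _
  exact hle (show srcComp K k q ∈ pathSpan (triIdeal K) 0 by rw [pathSpan_zero]; trivial)

theorem linearIndependent_curveFam (t : K) : LinearIndependent K (curveFam k t) := by
  rw [Fintype.linearIndependent_iff]
  intro g hg
  have h1 : ∑ i, g i • curveFam k t i = (curvePt k t).mkQ
      (∑ i, g i • pathClass (triIdeal K) (pathTo i) • topElt (triIdeal K) m (srcIdx k)) := by
    rw [map_sum]
    refine Finset.sum_congr rfl fun i _ => ?_
    rw [LinearMap.map_smul_of_tower, map_smul]
    rfl
  rw [h1, Submodule.mkQ_apply, Submodule.Quotient.mk_eq_zero] at hg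
  obtain ⟨s, hs⟩ := (mem_curvePt k).1 hg
  rw [map_sum] at hs
  simp only [srcComp_smul_smul, TriVertex.sum_eq, pathTo, linePt] at hs
  have h2 : ∀ q : QPath TriVertex, _ := fun q =>
    congrArg (fun x => (triBasis K).repr x q) hs
  simp only [map_add, map_smul, Finsupp.add_apply, Finsupp.smul_apply, triBasis_repr,
    smul_eq_mul] at h2
  have hne : cPath ≠ longPath := cPath_ne_longPath
  have e1 := h2 ⟨source, source, Quiver.Path.nil⟩
  have e2 := h2 ⟨source, middle, aPath⟩
  have e3 := h2 ⟨source, sink, cPath⟩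
  have e4 := h2 ⟨source, sink, longPath⟩
  simp [hne, hne.symm] at e1 e2 e3 e4
  rw [← e4, zero_mul] at e3
  intro i
  cases i
  · exact e1
  · exact e2
  · exact e3

/-- Paths of positive length move the basis of `Q / C_t` into the span of `a x` and `c x`. -/
theorem pathClass_smul_curveFam_mem (t : K) {i j : TriVertex} (p : Quiver.Path i j)
    (hp : 0 < p.length) (l : TriVertex) :
    pathClass (triIdeal K) p • curveFam k t l ∈
      Submodule.span K (curveFam k t '' {i | 1 ≤ min (rank i) 1}) := by
  by_cases hl : l = i
  · subst hl
    rw [curveFam, smul_smul, pathClass_mul_comp]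
    have hlen : 0 < ((pathTo l).comp p).length := by
      rw [Quiver.Path.length_comp]
      omega
    revert hlen
    refine path_source_cases (P := fun _ p => 0 < p.length →
      pathClass (triIdeal K) p • curveGen k t ∈
        Submodule.span K (curveFam k t '' {i | 1 ≤ min (rank i) 1})) ?_ ?_ ?_ ?_ _
    · intro h
      simp at h
    · exact fun _ => Submodule.subset_span ⟨middle, by simp [rank], rfl⟩
    · exact fun _ => Submodule.subset_span ⟨sink, by simp [rank], rfl⟩
    · intro _
      rw [longPath_smul_curveGen]
      exact Submodule.smul_mem _ _ (Submodule.subset_span ⟨sink, by simp [rank], rfl⟩)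
  · rw [pathClass_smul_of_ne (curveFam_normed k t l) p hl]
    exact Submodule.zero_mem _

theorem radPow_zero_curve (t : K) :
    (radPow (BoundAlg (triIdeal K)) (ProjMod (triIdeal K) m ⧸ curvePt k t) 0).restrictScalars K =
      Submodule.span K (curveFam k t '' {i | 0 ≤ min (rank i) 1}) := by
  have h : {i : TriVertex | 0 ≤ min (rank i) 1} = Set.univ := by
    ext i; simp
  rw [radPow_zero, h, Set.image_univ, span_curveFam]
  rfl

theorem radPow_one_curve (t : K) :
    (radPow (BoundAlg (triIdeal K)) (ProjMod (triIdeal K) m ⧸ curvePt k t) 1).restrictScalars K =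
      Submodule.span K (curveFam k t '' {i | 1 ≤ min (rank i) 1}) := by
  refine le_antisymm ?_ (Submodule.span_le.2 ?_)
  · rw [radPow_one, jacobson_smul_eq_span (isAdmissible_triIdeal K), Submodule.span_le]
    rintro _ ⟨i, j, e, n, -, rfl⟩
    have hn : n ∈ Submodule.span K (Set.range (curveFam k t)) := by
      rw [span_curveFam]
      trivial
    rw [SetLike.mem_coe]
    refine Submodule.span_induction (p := fun n _ => pathClass (triIdeal K) e.toPath • n ∈
      Submodule.span K (curveFam k t '' {i | 1 ≤ min (rank i) 1})) ?_ ?_ ?_ ?_ hn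
    · rintro _ ⟨l, rfl⟩
      exact pathClass_smul_curveFam_mem k t e.toPath (by simp) l
    · rw [smul_zero]
      exact Submodule.zero_mem _
    · intro x y _ _ hx hy
      rw [smul_add]
      exact Submodule.add_mem _ hx hy
    · intro a x _ hx
      rw [smul_comm]
      exact Submodule.smul_mem _ a hx
  · rintro _ ⟨i, hi, rfl⟩
    have hlen : 1 ≤ (pathTo i).length := by
      cases i with
      | source => simp [rank] at hi
      | middle => exact le_rfl
      | sink => exact le_rfl
    have h : curveFam k t i ∈ radPow (BoundAlg (triIdeal K))
        (ProjMod (triIdeal K) m ⧸ curvePt k t) (pathTo i).length :=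
      pathClass_smul_mem_radPow (isAdmissible_triIdeal K) (pathTo i) (curveGen k t)
    rw [Submodule.coe_restrictScalars]
    exact radPow_antitone _ _ hlen h

theorem radPow_two_curve_zero :
    radPow (BoundAlg (triIdeal K)) (ProjMod (triIdeal K) m ⧸ curvePt k (0 : K)) 2 = ⊥ := by
  have h : (radPow (BoundAlg (triIdeal K)) (ProjMod (triIdeal K) m ⧸ curvePt k (0 : K))
      2).restrictScalars K ≤ ⊥ := by
    rw [radPow_succ, jacobson_smul_eq_span (isAdmissible_triIdeal K), Submodule.span_le]
    rintro _ ⟨i, j, e, n, hn, rfl⟩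
    have hle : Submodule.span K (curveFam k (0 : K) '' {i | 1 ≤ min (rank i) 1}) ≤
        LinearMap.ker (Algebra.lsmul K K (ProjMod (triIdeal K) m ⧸ curvePt k (0 : K))
            (pathClass (triIdeal K) e.toPath)) := by
      refine Submodule.span_le.2 ?_
      rintro _ ⟨l, hl, rfl⟩
      change pathClass (triIdeal K) e.toPath • curveFam k (0 : K) l = 0
      by_cases hli : l = i
      · subst hli
        rw [curveFam, smul_smul, pathClass_mul_comp]
        have hlen : 1 < ((pathTo l).comp e.toPath).length := by
          rw [Quiver.Path.length_comp]
          cases l with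
          | source => simp [rank] at hl
          | middle => simp [pathTo, aPath]
          | sink => simp [pathTo, cPath]
        revert hlen
        refine path_source_cases (P := fun _ p => 1 < p.length →
          pathClass (triIdeal K) p • curveGen k (0 : K) = 0) ?_ ?_ ?_ ?_ _
        · intro h
          simp at h
        · intro h
          simp [aPath] at h
        · intro h
          simp [cPath] at h
        · intro _
          rw [longPath_smul_curveGen, neg_zero, zero_smul]
      · exact pathClass_smul_of_ne (curveFam_normed k (0 : K) l) _ hli
    rw [← Submodule.restrictScalars_mem K, radPow_one_curve] at hn
    exact hle hn
  rw [eq_bot_iff]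
  exact h

/-- For `t ≠ 0`, the element `c x = - t⁻¹ b a x` lies in `J ^ 2 (Q / C_t)`. -/
theorem curveFam_sink_mem_radPow_two {t : K} (ht : t ≠ 0) : curveFam k t sink ∈
    radPow (BoundAlg (triIdeal K)) (ProjMod (triIdeal K) m ⧸ curvePt k t) 2 := by
  have h := pathClass_smul_mem_radPow (isAdmissible_triIdeal K) longPath (curveGen k t)
  rw [longPath_smul_curveGen] at h
  have h2 := Submodule.smul_of_tower_mem _ (-t)⁻¹ h
  rwa [smul_smul, inv_mul_cancel₀ (neg_ne_zero.2 ht), one_smul] at h2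

theorem card_fiber_layerSeq (l : Fin 3) (i : TriVertex) :
    Nat.card {j : {j : TriVertex // min (rank j) 1 = l} // j.1 = i} = layerSeq l i := by
  rw [layerSeq]
  split_ifs with h
  · rw [Nat.card_eq_one_iff_unique]
    exact ⟨⟨fun a b => Subtype.ext (Subtype.ext (a.2.trans b.2.symm))⟩, ⟨⟨⟨i, h⟩, rfl⟩⟩⟩
  · rw [Nat.card_eq_zero]
    left
    exact ⟨fun a => h (a.2 ▸ a.1.2)⟩

/-- The radical layers of `Q / C_0` are spanned by `x` and by `a x`, `c x`, since `b a x = 0`. -/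
theorem hasRadLayering_curve_zero :
    HasRadLayering (triIdeal K) (ProjMod (triIdeal K) m ⧸ curvePt k (0 : K)) layerSeq := by
  refine hasRadLayering_of_adapted (isAdmissible_triIdeal K) (curveFam_normed k 0)
    (linearIndependent_curveFam k 0) (ℓ := fun i => min (rank i) 1) (fun l => ?_)
    card_fiber_layerSeq
  match l with
  | 0 => exact radPow_zero_curve k 0
  | 1 => exact radPow_one_curve k 0
  | l + 2 =>
    have h1 : radPow (BoundAlg (triIdeal K)) (ProjMod (triIdeal K) m ⧸ curvePt k (0 : K))
        (l + 2) = ⊥ :=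
      le_bot_iff.1 ((radPow_antitone _ _ (Nat.le_add_left 2 l)).trans
        (radPow_two_curve_zero k).le)
    have h2 : {i : TriVertex | l + 2 ≤ min (rank i) 1} = ∅ := by
      ext i
      simp
    rw [h1, h2, Set.image_empty, Submodule.span_empty]
    rfl

theorem hasTop_curve (t : K) :
    HasTop (triIdeal K) (ProjMod (triIdeal K) m ⧸ curvePt k t) (layerSeq 0) :=
  hasTop_of_radLayer_zero (radLayer_equiv_of_adapted (isAdmissible_triIdeal K)
    (curveFam_normed k t) (linearIndependent_curveFam k t) (ℓ := fun i => min (rank i) 1)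
    (radPow_zero_curve k t) (radPow_one_curve k t) (card_fiber_layerSeq 0))

theorem hasDimVec_curve (t : K) :
    HasDimVec (triIdeal K) (ProjMod (triIdeal K) m ⧸ curvePt k t) fun _ => 1 :=
  hasDimVec_of_basis (curveFam_normed k t) (linearIndependent_curveFam k t)
    (span_curveFam k t) fun i => by simp

theorem finrank_curvePt (t : K) :
    Module.finrank K (curvePt (m := m) k t) + ∑ _i : TriVertex, 1 =
      Module.finrank K (ProjMod (triIdeal K) m) := by
  have := finite_projMod (isAdmissible_triIdeal K) m
  have h1 := Submodule.finrank_quotient_add_finrank ((curvePt (m := m) k t).restrictScalars K)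
  have h2 := Module.finrank_eq_card_basis
    (Module.Basis.mk (linearIndependent_curveFam k t) (span_curveFam k t).ge)
  have h3 : Module.finrank K (ProjMod (triIdeal K) m ⧸ (curvePt k t).restrictScalars K) =
      Module.finrank K (ProjMod (triIdeal K) m ⧸ curvePt k t) := rfl
  have h4 : Module.finrank K ((curvePt (m := m) k t).restrictScalars K) =
      Module.finrank K (curvePt (m := m) k t) := rfl
  rw [← h1, h3, h4, h2, Finset.sum_const, Finset.card_univ, smul_eq_mul, mul_one, add_comm]

theorem nilpotencyClass_jacobson_triIdeal :
    nilpotencyClass (Ring.jacobson (BoundAlg (triIdeal K))) = 2 + 1 := by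
  have hw : pathClass (triIdeal K) longPath ≠ 0 := by
    rw [← triBasis_apply]
    exact (triBasis K).ne_zero _
  have hJ : ∀ {i j : TriVertex} (p : Quiver.Path i j), 0 < p.length →
      pathClass (triIdeal K) p ∈ Ring.jacobson (BoundAlg (triIdeal K)) :=
    fun p => pathClass_mem_jacobson (isAdmissible_triIdeal K) p
  have h3 : Ring.jacobson (BoundAlg (triIdeal K)) ^ 3 = 0 := by
    refine le_bot_iff.1 fun x hx => ?_
    have h := jacobson_pow_le_pathSpan (isAdmissible_triIdeal K) 3 hx
    have h0 : pathSpan (triIdeal K) 3 = ⊥ := by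
      refine le_bot_iff.1 (Submodule.span_le.2 ?_)
      rintro _ ⟨i, j, p, hp, -⟩
      exact absurd (length_lt_three p) (by omega)
    rw [h0, Submodule.mem_bot] at h
    rw [h]
    exact Submodule.zero_mem _
  refine le_antisymm (Nat.sInf_le h3) (le_csInf ⟨3, h3⟩ fun n hn => ?_)
  by_contra hlt
  have hmem : pathClass (triIdeal K) longPath ∈ Ring.jacobson (BoundAlg (triIdeal K)) ^ n := by
    match n, hlt with
    | 0, _ =>
      rw [Submodule.pow_zero, Submodule.one_eq_span]
      exact Submodule.mem_span_singleton.2 ⟨_, mul_one _⟩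
    | 1, _ =>
      rw [Submodule.pow_one]
      exact hJ longPath (Nat.zero_lt_succ _)
    | 2, _ =>
      rw [Submodule.pow_succ, Submodule.pow_one]
      have h : pathClass (triIdeal K) longPath =
          pathClass (triIdeal K) bPath * pathClass (triIdeal K) aPath :=
        (pathClass_mul_comp (triIdeal K) bPath aPath).symm
      rw [h]
      exact Ideal.mul_mem_mul (hJ bPath (Nat.zero_lt_succ _)) (hJ aPath (Nat.zero_lt_succ _))
    | n + 3, h => exact absurd (Nat.le_add_left 3 n) h
  rw [hn] at hmem
  exact hw ((Submodule.mem_bot _).1 hmem)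

/-- The radical layers of `Q / C_0` are quotients of those of `Q`, so that they embed into them by
semisimplicity. -/
theorem isSemisimpleSequence_layerSeq :
    IsSemisimpleSequence (L := 2) (triIdeal K) (fun _ => 1) layerSeq := by
  refine ⟨fun i => ?_, fun l => ?_⟩
  · rw [Fin.sum_univ_three]
    cases i <;> simp [layerSeq, rank]
  · have k : Fin (layerSeq 0 source) := ⟨0, by simp [layerSeq, rank]⟩
    exact (hasRadLayering_curve_zero (K := K) k).exists_injective (K := K) (isAdmissible_triIdeal K)
      (curvePt k (0 : K)).mkQ (curvePt k (0 : K)).mkQ_surjective l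

/-- For `t ≠ 0`, the last radical layer of `Q / C_t` is nonzero, whereas that of the sequence is
zero. -/
theorem not_hasRadLayering_curve {t : K} (ht : t ≠ 0) :
    ¬ HasRadLayering (triIdeal K) (ProjMod (triIdeal K) m ⧸ curvePt k t) layerSeq := by
  intro h
  obtain ⟨φ⟩ := h 2
  have hS : ∀ i, layerSeq 2 i = 0 := by
    intro i
    cases i <;> simp [layerSeq, rank]
  have hsub : Subsingleton (SemisimpleMod (triIdeal K) (layerSeq 2)) :=
    ⟨fun f g => funext fun i => funext fun k => (Fin.cast (hS i) k).elim0⟩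
  have h1 : (⟨_, _, curveFam_sink_mem_radPow_two k ht, rfl⟩ : radLayer (BoundAlg (triIdeal K))
      (ProjMod (triIdeal K) m ⧸ curvePt k t) 2) = 0 :=
    φ.injective (Subsingleton.elim _ _)
  have h2 := congrArg Subtype.val h1
  have h3 := (Submodule.Quotient.mk_eq_zero _).1 h2
  rw [radPow_eq_bot_of_nilpotencyClass (L := 2) nilpotencyClass_jacobson_triIdeal] at h3
  exact (linearIndependent_curveFam k t).ne_zero sink h3

theorem curvePt_le_jacobson (k : Fin (layerSeq 0 source)) (t : K) :
    curvePt (m := layerSeq 0) k t ≤ Ring.jacobson (BoundAlg (triIdeal K)) • ⊤ := by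
  intro q hq
  obtain ⟨s, hs⟩ := (mem_curvePt k).1 hq
  have huniq : ∀ r : TopIdx (layerSeq 0), r = srcIdx k := by
    rintro ⟨i, j⟩
    cases i with
    | source =>
      have : Subsingleton (Fin (layerSeq 0 source)) := by
        have h : layerSeq 0 source = 1 := by simp [layerSeq, rank]
        rw [h]
        infer_instance
      rw [Subsingleton.elim j k]
    | middle => exact (Fin.cast (by simp [layerSeq, rank]) j : Fin 0).elim0
    | sink => exact (Fin.cast (by simp [layerSeq, rank]) j : Fin 0).elim0
  have h : q = srcComp K k q • topElt (triIdeal K) (layerSeq 0) (srcIdx k) := by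
    funext r
    obtain rfl := huniq r
    refine Subtype.ext ?_
    have h2 := srcComp_mul_vert k q
    change srcComp K k q = srcComp K k (srcComp K k q • _)
    rw [map_smul, srcComp_topElt, smul_eq_mul, h2]
  rw [h, hs]
  refine Submodule.smul_mem_smul ?_ trivial
  refine Submodule.smul_of_tower_mem _ s (add_mem ?_ (Submodule.smul_of_tower_mem _ t ?_))
  · exact pathClass_mem_jacobson (isAdmissible_triIdeal K) _ (by simp [longPath])
  · exact pathClass_mem_jacobson (isAdmissible_triIdeal K) _ (by simp [cPath])

end TriangleModules

/-! ### Openness and its failure -/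

section TriangleSkeleta

variable {K : Type w} [Field K]

local instance : Ring (BoundAlg (triIdeal K)) := inferInstance
local instance : Semiring (BoundAlg (triIdeal K)) := inferInstance
local instance : AddCommGroup (BoundAlg (triIdeal K)) := inferInstance

theorem curve_not_isDistinguished {m : TriVertex → ℕ} (k : Fin (m source)) {σ : Set (HatPath m)}
    (hσ : IsSkeleton 2 (layerSeq 0) σ) (hS : Compatible (L := 2) layerSeq σ) {t : K} (ht : t ≠ 0) :
    ¬ IsDistinguished (triIdeal K) 2 σ (curvePt k t) := by
  have := finite_projMod (isAdmissible_triIdeal K) m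
  intro h
  exact not_hasRadLayering_curve k ht ((isDistinguished_iff (isAdmissible_triIdeal K)
    nilpotencyClass_jacobson_triIdeal hσ hS).1 h).1

theorem exists_isDistinguished_curve_zero (K : Type w) [Field K] {m : TriVertex → ℕ}
    (k : Fin (m source)) : ∃ σ : Set (HatPath m), IsSkeleton 2 (layerSeq 0) σ ∧
      Compatible (L := 2) layerSeq σ ∧ IsDistinguished (triIdeal K) 2 σ (curvePt k (0 : K)) := by
  have := finite_projMod (isAdmissible_triIdeal K) m
  exact exists_isDistinguished (isAdmissible_triIdeal K) nilpotencyClass_jacobson_triIdeal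
    (hasRadLayering_curve_zero k)

theorem not_isZariskiOpenIn_curve [Infinite K] {m : TriVertex → ℕ} (k : Fin (m source))
    {X Y : Set (Submodule (BoundAlg (triIdeal K)) (ProjMod (triIdeal K) m))}
    (h0 : curvePt k (0 : K) ∈ Y) (hX : ∀ t : K, curvePt k t ∈ X)
    (hY : ∀ t : K, t ≠ 0 → curvePt k t ∉ Y) : ¬ IsZariskiOpenIn K Y X :=
  not_isZariskiOpenIn_of_curve (N := nilEnd K k) (injective_id_add_smul_nilEnd k)
    (C := fun t => curvePt k t) (map_curvePt k) h0 hX hY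

theorem curvePt_mem_smallGrassTotal (k : Fin (layerSeq 0 source)) (t : K) :
    curvePt k t ∈ smallGrassTotal (triIdeal K) (layerSeq 0) (∑ _i : TriVertex, 1) :=
  ⟨curvePt_le_jacobson k t, finrank_curvePt k t⟩

theorem curvePt_mem_smallGrassTop (k : Fin (layerSeq 0 source)) (t : K) :
    curvePt k t ∈ smallGrassTop (triIdeal K) (layerSeq 0) fun _ => 1 :=
  ⟨curvePt_mem_smallGrassTotal k t, hasDimVec_curve k t⟩

theorem curvePt_mem_bigGrassDim (k : Fin 1) (t : K) :
    curvePt (m := fun _ => 1) k t ∈ bigGrassDim (triIdeal K) fun _ => 1 :=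
  ⟨finrank_curvePt (m := fun _ => 1) k t, hasDimVec_curve (m := fun _ => 1) k t⟩

end TriangleSkeleta

end

theorem corollary3p8 (K : Type w) [Field K] [IsAlgClosed K] :
    (∀ (V : Type u) [Fintype V] [Quiver.{v} V] [∀ i j : V, Finite (i ⟶ j)]
        (I : Ideal (PathAlgebra K V)) [I.IsTwoSided] (L : ℕ) (d : V → ℕ)
        (S : Fin (L + 1) → V → ℕ),
        IsAdmissible I →
        nilpotencyClass (Ring.jacobson (BoundAlg I)) = L + 1 →
        IsSemisimpleSequence I d S →
        -- the small scenario
        ((∀ σ : Set (HatPath (S 0)), IsSkeleton L (S 0) σ → Compatible S σ →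
            IsZariskiOpenIn K (smallGrassSkel I L (S 0) d σ) (smallGrass I d S) ∧
            smallGrassSkel I L (S 0) d σ = smallGrass I d S ∩ smallSchu I (S 0) d σ) ∧
          (⋃ σ ∈ {σ : Set (HatPath (S 0)) | IsSkeleton L (S 0) σ ∧ Compatible S σ},
            smallGrassSkel I L (S 0) d σ) = smallGrass I d S) ∧
        -- the big scenario
        ((∀ σ : Set (HatPath d), IsSkeleton L (S 0) σ → Compatible S σ →
            IsZariskiOpenIn K (bigGrassSkel I L d σ) (bigGrass I d S) ∧
            bigGrassSkel I L d σ = bigGrass I d S ∩ bigSchu I d σ) ∧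
          (⋃ σ ∈ {σ : Set (HatPath d) | IsSkeleton L (S 0) σ ∧ Compatible S σ},
            bigGrassSkel I L d σ) = bigGrass I d S)) ∧
    -- failure of openness in the ambient varieties
    (∃ (V : Type) (_ : Fintype V) (_ : Quiver.{0} V) (_ : ∀ i j : V, Finite (i ⟶ j))
        (I : Ideal (PathAlgebra K V)) (_ : I.IsTwoSided) (L : ℕ) (d : V → ℕ)
        (S : Fin (L + 1) → V → ℕ) (σ : Set (HatPath (S 0))) (σ' : Set (HatPath d)),
        IsAdmissible I ∧
        nilpotencyClass (Ring.jacobson (BoundAlg I)) = L + 1 ∧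
        IsSemisimpleSequence I d S ∧
        IsSkeleton L (S 0) σ ∧ Compatible S σ ∧
        IsSkeleton L (S 0) σ' ∧ Compatible S σ' ∧
        ¬ IsZariskiOpenIn K (smallGrassSkel I L (S 0) d σ) (smallGrassTotal I (S 0) (∑ i, d i)) ∧
        ¬ IsZariskiOpenIn K (smallGrassSkel I L (S 0) d σ) (smallGrassTop I (S 0) d) ∧
        ¬ IsZariskiOpenIn K (bigGrassSkel I L d σ') (bigGrassTop I (S 0) d)) := by
  refine ⟨?_, ?_⟩
  · intro V _ _ _ I _ L d S hI hL hS
    have := finite_projMod hI (S 0)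
    have := finite_projMod hI d
    exact ⟨⟨fun σ hσ hc => ⟨isZariskiOpenIn_smallGrassSkel hI hL hS.sum_eq hσ hc,
        smallGrassSkel_eq hI hL hS.sum_eq hσ hc⟩, iUnion_smallGrassSkel hI hL hS.sum_eq⟩,
      ⟨fun σ hσ hc => ⟨isZariskiOpenIn_bigGrassSkel hI hL hσ hc, bigGrassSkel_eq hI hL hσ hc⟩,
        iUnion_bigGrassSkel hI hL⟩⟩
  · have : Infinite K := IsAlgClosed.instInfinite
    -- the only top element in the small scenario, and the one normed by the source in the big one
    let k : Fin (TriVertex.layerSeq 0 TriVertex.source) :=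
      ⟨0, by simp [TriVertex.layerSeq, TriVertex.rank]⟩
    let k' : Fin 1 := 0
    obtain ⟨σ, hσ, hS, hC⟩ := exists_isDistinguished_curve_zero K k
    obtain ⟨σ', hσ', hS', hC'⟩ := exists_isDistinguished_curve_zero K (m := fun _ => 1) k'
    refine ⟨TriVertex, inferInstance, inferInstance, inferInstance, triIdeal K, inferInstance, 2,
      fun _ => 1, TriVertex.layerSeq, σ, σ', isAdmissible_triIdeal K,
      nilpotencyClass_jacobson_triIdeal, isSemisimpleSequence_layerSeq, hσ, hS, hσ', hS', ?_, ?_, ?_⟩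
    · exact not_isZariskiOpenIn_curve k ⟨curvePt_mem_smallGrassTotal k 0, hC⟩
        (curvePt_mem_smallGrassTotal k)
        fun t ht h => curve_not_isDistinguished k hσ hS ht h.2
    · exact not_isZariskiOpenIn_curve k ⟨curvePt_mem_smallGrassTotal k 0, hC⟩
        (curvePt_mem_smallGrassTop k)
        fun t ht h => curve_not_isDistinguished k hσ hS ht h.2
    · exact not_isZariskiOpenIn_curve (m := fun _ => 1) k' ⟨curvePt_mem_bigGrassDim k' 0, hC'⟩
        (fun t => ⟨curvePt_mem_bigGrassDim k' t, hasTop_curve (m := fun _ => 1) k' t⟩)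
        fun t ht h => curve_not_isDistinguished (m := fun _ => 1) k' hσ' hS' ht h.2
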